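/- Let $R=\bigoplus_{n\ge 0}R^n$ be a graded-commutative Noetherian ring with $R=R^0[R^d]$ for an even integer $d\ge 2$ (so $R$ lives in even degrees and is commutative), and let $\mathsf T$ be an $R$-linear triangulated category with shift $\Sigma$: there is a homomorphism of graded rings $\phi$ from $R$ to the graded center of $\mathsf T$, whose degree $n$ part consists of the natural transformations $\eta:\mathrm{id}\to\Sigma^n$ with $\eta\Sigma=(-1)^n\Sigma\eta$. Then $\operatorname{Hom}^*(X,Y)=\bigoplus_{n\in\mathbb Z}\operatorname{Hom}_{\mathsf T}(X,\Sigma^nY)$ is a graded $R$-module for all objects $X,Y$. For every object $Y$ and $z\in R^d$ fix a Koszul object $Y/\!\!/z$, that is, an object in a distinguished triangle $Y\xrightarrow{\phi_Y(z)}\Sigma^dY\to Y/\!\!/z\to\Sigma Y$. Let $\lambda^n(X,Y)$ be the length of $\operatorname{Hom}_{\mathsf T}(X,\Sigma^nY)$ over $R^0$. Say that $\operatorname{Hom}^*(X,Y)$ is in $\mathsf{noeth}^{\mathsf{fl}}(R)$ if $\bigoplus_{n\ge n_0}\operatorname{Hom}_{\mathsf T}(X,\Sigma^nY)$ is a Noetherian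 $R$-module for some $n_0\in\mathbb Z$, and $\lambda^n(X,Y)<\infty$ for all $n$. In that case there are unique polynomials $g_0,\dots,g_{d-1}\in\mathbb Q[t]$ with $g_i(n)=\lambda^{dn+i}(X,Y)$ for $n\gg0$, and $\operatorname{cx}(X,Y)=1+\max_i\deg g_i$, where the zero polynomial has degree $-1$. Put $$h(X,Y)(n)=\sum_{i=0}^{d-1}(-1)^{n+i}\lambda^{n+i}(X,Y),\qquad \Delta f(n)=f(n+d)-f(n).$$ For $s\ge\operatorname{cx}(X,Y)$ the $s$-multiplicity $e^s(X,Y)$ is the constant value of $\Delta^{s-1}h(X,Y)(n)$ for $n\gg0$ if $s\ge1$, and $e^0(X,Y)=\sum_{n\in\mathbb Z}(-1)^n\lambda^n(X,Y)$ if $s=0$ and $\lambda^n(X,Y)=0$ for $n\ll0$. An element $z\in R^d$ is eventually injective on $\operatorname{Hom}^*(X,Y)$ if multiplication by $z$ from $\operatorname{Hom}_{\mathsf T}(X,\Sigma^nY)$ to $\operatorname{Hom}_{\mathsf T}(X,\Sigma^{n+d}Y)$ is injective for $n\gg0$. For every $s\ge0$ let $f^s$ be a $\mathbb Z$-valued function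 on the pairs $(X,Y)$ of objects of $\mathsf T$ such that $\operatorname{Hom}^*(X,Y)$ is in $\mathsf{noeth}^{\mathsf{fl}}(R)$, $\lambda^n(X,Y)=0$ for $n\ll0$, and $\operatorname{cx}(X,Y)\le s$. Consider the following axioms. 1. If $s>\operatorname{cx}(X,Y)$, then $f^s(X,Y)=0$. 2. If $\operatorname{cx}(X,Y)=0$, then $f^0(X,Y)=\sum_{n\in\mathbb Z}(-1)^n\lambda^n(X,Y)$. 3. If $s=\operatorname{cx}(X,Y)>0$ and $z\in R^d$ is eventually injective on $\operatorname{Hom}^*(X,Y)$, then $f^s(X,Y)=f^{s-1}(X,Y/\!\!/z)$. Suppose that $R^0$ either contains an infinite field or is local with infinite residue field. If the family $(f^s)_{s\ge0}$ satisfies axioms 1, 2 and 3, then $f^s(X,Y)=e^s(X,Y)$ for all $s\ge0$ and all $(X,Y)$ in the domain of $f^s$. Conversely, the family $(e^s)_{s\ge0}$ satisfies the axioms; so the axioms characterize the multiplicity. -/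

import Mathlib

open CategoryTheory CategoryTheory.Pretriangulated
open scoped DirectSum

noncomputable section

namespace TriangMult

universe v u w

section GradedCenter

variable (C : Type u) [Category.{v} C] [Preadditive C] [HasShift C ℤ]
  [∀ n : ℤ, (shiftFunctor C n).Additive]

/-- The degree `n` component of the graded center of `C` (with shift functor `Σ`): the natural
transformations `η : id ⟶ Σⁿ` such that `η Σ = (-1)ⁿ Σ η`. The canonical isomorphism
`Σ Σⁿ ≅ Σⁿ Σ` is made explicit. -/
def GradedCenter (n : ℤ) : AddSubgroup (𝟭 C ⟶ shiftFunctor C n) where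
  carrier := {η | ∀ X : C, η.app (X⟦(1 : ℤ)⟧) =
    n.negOnePow • ((η.app X)⟦(1 : ℤ)⟧' ≫ (shiftComm X n 1).hom)}
  zero_mem' := by
    intro X
    simp
  add_mem' := by
    intro a b ha hb X
    have ha' := ha X
    have hb' := hb X
    simp only [NatTrans.app_add, Functor.map_add, Preadditive.add_comp, smul_add]
    rw [ha', hb']
  neg_mem' := by
    intro a ha X
    have ha' := ha X
    simp only [NatTrans.app_neg, Functor.map_neg, Preadditive.neg_comp, smul_neg]
    rw [ha']

end GradedCenter

variable {R : Type w} [CommRing R] (𝒜 : ℕ → AddSubgroup R) [GradedRing 𝒜]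
variable (C : Type u) [Category.{v} C] [Preadditive C] [HasShift C ℤ]
  [∀ n : ℤ, (shiftFunctor C n).Additive]

/-- A central action of the graded ring `R = ⨁ 𝒜 m` on `C`: a homomorphism of graded rings
from `R` to the graded center of `C`. The product in the graded center is given by composition,
`(η ζ)_X = Σⁿ(η_X) ∘ ζ_X` for `ζ` of degree `n`, which is `ShiftedHom.comp`. -/
structure CentralAction where
  /-- the homogeneous components of the ring homomorphism -/
  toCenter (m : ℕ) : 𝒜 m →+ GradedCenter C (m : ℤ)
  map_one (X : C) : (toCenter 0 1).1.app X = ShiftedHom.mk₀ ((0 : ℕ) : ℤ) (by simp) (𝟙 X)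
  map_mul {m n : ℕ} (r : 𝒜 m) (s : 𝒜 n) (X : C) :
    (toCenter (m + n) ⟨(r : R) * s, SetLike.mul_mem_graded r.2 s.2⟩).1.app X =
      ShiftedHom.comp (Y := X) (Z := X) (c := ((m + n : ℕ) : ℤ))
        ((toCenter n s).1.app X) ((toCenter m r).1.app X) (by push_cast; rfl)

variable {𝒜 C}
variable (φ : CentralAction 𝒜 C)

/-- The morphism `φ_X(r) : X ⟶ Σᵐ X` given by a homogeneous element `r` of degree `m`. -/
def CentralAction.app {m : ℕ} (r : 𝒜 m) (X : C) : X ⟶ X⟦(m : ℤ)⟧ :=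
  (φ.toCenter m r).1.app X

lemma CentralAction.app_add {m : ℕ} (r s : 𝒜 m) (X : C) :
    φ.app (r + s) X = φ.app r X + φ.app s X := by
  simp [CentralAction.app]

/-- The degree `n` part `Hom(X, Σⁿ Y)` of `Hom*(X, Y)`; the central action is recorded in the type
because it determines the module structure. -/
def HomDeg (_φ : CentralAction 𝒜 C) (X Y : C) (n : ℤ) : Type v := ShiftedHom X Y n

instance (X Y : C) (n : ℤ) : AddCommGroup (HomDeg φ X Y n) :=
  inferInstanceAs (AddCommGroup (X ⟶ Y⟦n⟧))

variable {φ} in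
/-- The action of a homogeneous element `r` of degree `m` on the graded group `Hom*(X, Y)`, i.e.
the map `Hom(X, Σⁿ Y) → Hom(X, Σⁿ⁺ᵐ Y)` induced by `Σⁿ φ_Y(r)`. -/
def act {X Y : C} {m : ℕ} (r : 𝒜 m) {n k : ℤ} (h : (m : ℤ) + n = k) :
    HomDeg φ X Y n →+ HomDeg φ X Y k where
  toFun f := ShiftedHom.comp (X := X) (Y := Y) (Z := Y) f (φ.app r Y) h
  map_zero' := ShiftedHom.zero_comp X n _ h
  map_add' f g := ShiftedHom.add_comp f g _ h

section ActLemmas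

variable {φ} {X Y : C}

lemma act_add_left {m : ℕ} (r s : 𝒜 m) {n k : ℤ} (h : (m : ℤ) + n = k) (f : HomDeg φ X Y n) :
    act (r + s) h f = act r h f + act s h f := by
  simp only [act, AddMonoidHom.coe_mk, CentralAction.app_add]
  exact ShiftedHom.comp_add _ _ _ _

lemma act_one {n k : ℤ} (h : ((0 : ℕ) : ℤ) + n = k) (f : HomDeg φ X Y n) :
    DirectSum.of (HomDeg φ X Y) k (act (1 : 𝒜 0) h f) = DirectSum.of (HomDeg φ X Y) n f := by
  obtain rfl : n = k := by simpa using h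
  congr 1
  simp only [act, AddMonoidHom.coe_mk, CentralAction.app, φ.map_one]
  exact ShiftedHom.comp_mk₀_id (X := X) (Y := Y) f ((0 : ℕ) : ℤ) (by simp)

lemma act_mul {m m' : ℕ} (r : 𝒜 m) (s : 𝒜 m') {n k l : ℤ} (h : (m' : ℤ) + n = k)
    (h' : (m : ℤ) + k = l) (h'' : ((m + m' : ℕ) : ℤ) + n = l) (f : HomDeg φ X Y n) :
    act (⟨(r : R) * s, SetLike.mul_mem_graded r.2 s.2⟩ : 𝒜 (m + m')) h'' f = act r h' (act s h f) := by
  simp only [act, AddMonoidHom.coe_mk, CentralAction.app, φ.map_mul]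
  exact (ShiftedHom.comp_assoc (X := X) (Y := Y) (Z := Y) (T := Y) f _ _ h (by push_cast; rfl)
    (by push_cast at h''; exact h'')).symm

end ActLemmas

/-- The `R⁰`-module structure on `Hom(X, Σⁿ Y)`. -/
instance homDegModule (X Y : C) (n : ℤ) : Module (𝒜 0) (HomDeg φ X Y n) where
  smul r f := act r (by simp) f
  one_smul f := DirectSum.of_injective n (act_one (by simp) f)
  mul_smul r s f := by
    have := act_mul (φ := φ) (X := X) (Y := Y) r s (n := n) (k := n) (l := n)
      (by simp) (by simp) (by simp) f
    exact this
  smul_zero r := map_zero _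
  smul_add r f g := map_add _ f g
  add_smul r s f := act_add_left r s _ f
  zero_smul f := by
    have := act_add_left (φ := φ) (X := X) (Y := Y) (0 : 𝒜 0) 0 (n := n) (k := n) (by simp) f
    rw [add_zero] at this
    exact left_eq_add.mp this

/-- The graded group `Hom*(X, Y) = ⨁ₙ Hom(X, Σⁿ Y)`. -/
def HomStar (X Y : C) : Type v := ⨁ n : ℤ, HomDeg φ X Y n

instance (X Y : C) : AddCommGroup (HomStar φ X Y) :=
  inferInstanceAs (AddCommGroup (⨁ n : ℤ, HomDeg φ X Y n))

/-- The inclusion of `Hom(X, Σⁿ Y)` into `Hom*(X, Y)`. -/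
def HomStar.of (X Y : C) (n : ℤ) : HomDeg φ X Y n →+ HomStar φ X Y :=
  DirectSum.of (HomDeg φ X Y) n

variable {φ} in
/-- The component in `Hom(X, Σⁿ Y)` of an element of `Hom*(X, Y)`. -/
def HomStar.coeff {X Y : C} (n : ℤ) : HomStar φ X Y →+ HomDeg φ X Y n :=
  DFinsupp.evalAddMonoidHom n

section ModuleStructure

variable {X Y : C}

/-- The additive endomorphism of `Hom*(X, Y)` given by a homogeneous element `r` of degree `m`;
on `Hom(X, Σⁿ Y)` it is `act r`. -/
def actHom (X Y : C) {m : ℕ} (r : 𝒜 m) : HomStar φ X Y →+ HomStar φ X Y :=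
  DirectSum.toAddMonoid (β := HomDeg φ X Y) fun n : ℤ =>
    (HomStar.of φ X Y ((m : ℤ) + n)).comp (act r rfl)

lemma actHom_of {m : ℕ} (r : 𝒜 m) (n : ℤ) (f : HomDeg φ X Y n) :
    actHom φ X Y r (HomStar.of φ X Y n f) = HomStar.of φ X Y ((m : ℤ) + n) (act r rfl f) :=
  DirectSum.toAddMonoid_of (β := HomDeg φ X Y) _ n f

lemma homStar_induction {φ : CentralAction 𝒜 C} {p : HomStar φ X Y → Prop} (x : HomStar φ X Y)
    (zero : p 0) (of : ∀ n f, p (HomStar.of φ X Y n f))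
    (add : ∀ x y, p x → p y → p (x + y)) : p x :=
  DirectSum.induction_on (β := HomDeg φ X Y) x zero of add

/-- The action of `R` on `Hom*(X, Y)`, obtained from `actHom` by additivity. -/
def smulHom (X Y : C) : R →+ HomStar φ X Y →+ HomStar φ X Y :=
  (DirectSum.toAddMonoid (β := fun m => 𝒜 m) fun _ : ℕ => AddMonoidHom.mk'
      (fun r => actHom φ X Y r)
      (by
        intro r s
        ext x
        induction x using homStar_induction with
        | zero => simp
        | add x y hx hy => rw [map_add, map_add, hx, hy]
        | of n f =>
          rw [AddMonoidHom.add_apply, actHom_of, actHom_of, actHom_of, act_add_left,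
            map_add])).comp
    (DirectSum.decomposeAddEquiv 𝒜).toAddMonoidHom

variable {φ}

lemma smulHom_of {m : ℕ} (r : 𝒜 m) {n k : ℤ} (h : (m : ℤ) + n = k) (f : HomDeg φ X Y n) :
    smulHom φ X Y (r : R) (HomStar.of φ X Y n f) = HomStar.of φ X Y k (act r h f) := by
  subst h
  have h1 : smulHom φ X Y (r : R) = actHom φ X Y r := by
    simp only [smulHom, AddMonoidHom.comp_apply]
    change DirectSum.toAddMonoid _ (DirectSum.decompose 𝒜 (r : R)) = _
    rw [DirectSum.decompose_coe, DirectSum.toAddMonoid_of]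
    rfl
  rw [h1, actHom_of]

lemma one_smulHom (x : HomStar φ X Y) : smulHom φ X Y 1 x = x := by
  induction x using homStar_induction with
  | zero => simp
  | add x y hx hy => rw [map_add, hx, hy]
  | of n f =>
    exact (smulHom_of (1 : 𝒜 0) (k := n) (by simp) f).trans (act_one (by simp) f)

lemma mul_smulHom (r s : R) (x : HomStar φ X Y) :
    smulHom φ X Y (r * s) x = smulHom φ X Y r (smulHom φ X Y s x) := by
  induction x using homStar_induction with
  | zero => simp
  | add x y hx hy => rw [map_add, map_add, map_add, hx, hy]
  | of n f =>
    induction r using DirectSum.Decomposition.inductionOn 𝒜 with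
    | zero => simp
    | add r r' hr hr' =>
      rw [add_mul, map_add, map_add, AddMonoidHom.add_apply, AddMonoidHom.add_apply, hr, hr']
    | homogeneous r =>
      rename_i m
      induction s using DirectSum.Decomposition.inductionOn 𝒜 with
      | zero => simp
      | add s s' hs hs' =>
        rw [mul_add, map_add, map_add, AddMonoidHom.add_apply, AddMonoidHom.add_apply, map_add,
          hs, hs']
      | homogeneous s =>
        rename_i m'
        rw [smulHom_of s rfl, smulHom_of r rfl, ← act_mul r s rfl rfl (by push_cast; ring)]
        exact smulHom_of (⟨(r : R) * s, SetLike.mul_mem_graded r.2 s.2⟩ : 𝒜 (m + m')) _ f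

end ModuleStructure

/-- The `R`-module structure on `Hom*(X, Y)`. -/
instance homStarModule (X Y : C) : Module R (HomStar φ X Y) where
  smul r x := smulHom φ X Y r x
  one_smul := one_smulHom
  mul_smul := mul_smulHom
  smul_zero r := map_zero (smulHom φ X Y r)
  smul_add r := map_add (smulHom φ X Y r)
  add_smul r s x := by
    have := map_add (smulHom φ X Y) r s
    exact DFunLike.congr_fun this x
  zero_smul x := by
    have := map_zero (smulHom φ X Y)
    exact DFunLike.congr_fun this x

section Truncation

variable {φ} {X Y : C}

lemma smul_of {m : ℕ} (r : 𝒜 m) {n k : ℤ} (h : (m : ℤ) + n = k) (f : HomDeg φ X Y n) :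
    (r : R) • HomStar.of φ X Y n f = HomStar.of φ X Y k (act r h f) :=
  smulHom_of r h f

lemma coeff_of_same (n : ℤ) (f : HomDeg φ X Y n) :
    HomStar.coeff n (HomStar.of φ X Y n f) = f :=
  DirectSum.of_eq_same n f

lemma coeff_of_ne {n k : ℤ} (h : n ≠ k) (f : HomDeg φ X Y n) :
    HomStar.coeff k (HomStar.of φ X Y n f) = 0 :=
  DirectSum.of_eq_of_ne n k f (Ne.symm h)

lemma coeff_smul {m : ℕ} (r : 𝒜 m) {n k : ℤ} (h : (m : ℤ) + n = k) (x : HomStar φ X Y) :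
    HomStar.coeff k ((r : R) • x) = act r h (HomStar.coeff n x) := by
  induction x using homStar_induction with
  | zero => simp
  | add x y hx hy => rw [smul_add, map_add, map_add, map_add, hx, hy]
  | of n' f =>
    rw [smul_of r rfl]
    by_cases hn : n' = n
    · subst hn h
      rw [coeff_of_same, coeff_of_same]
    · rw [coeff_of_ne hn, coeff_of_ne (by omega), map_zero]

end Truncation

/-- The `R`-submodule `Hom^{≥ n₀}(X, Y) = ⨁_{n ≥ n₀} Hom(X, Σⁿ Y)` of `Hom*(X, Y)`. -/
def HomGE (X Y : C) (n₀ : ℤ) : Submodule R (HomStar φ X Y) where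
  carrier := {x | ∀ n < n₀, HomStar.coeff n x = 0}
  zero_mem' := fun n _ => map_zero _
  add_mem' := by
    intro x y hx hy n hn
    rw [map_add, hx n hn, hy n hn, add_zero]
  smul_mem' := by
    intro r x hx
    induction r using DirectSum.Decomposition.inductionOn 𝒜 with
    | zero =>
      intro n _
      rw [zero_smul, map_zero]
    | add r s hr hs =>
      intro n hn
      rw [add_smul, map_add, hr n hn, hs n hn, add_zero]
    | homogeneous r =>
      rename_i m
      intro n hn
      rw [coeff_smul r (n := n - m) (by ring), hx _ (by omega), map_zero]

/-- The length `λⁿ(X, Y)` of `Hom(X, Σⁿ Y)` over `R⁰`, possibly infinite. -/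
def homLength (X Y : C) (n : ℤ) : ℕ∞ := Module.length (𝒜 0) (HomDeg φ X Y n)

/-- The length `λⁿ(X, Y)` as a natural number, meaningful when it is finite. -/
def lam (X Y : C) (n : ℤ) : ℕ := (homLength φ X Y n).toNat

/-- `Hom*(X, Y)` belongs to `noeth^fl(R)`: it is eventually Noetherian over `R`, and all its
components have finite length over `R⁰`. -/
structure NoethFL (X Y : C) : Prop where
  eventually_noetherian : ∃ n₀ : ℤ, IsNoetherian R (HomGE φ X Y n₀)
  finite_length : ∀ n : ℤ, homLength φ X Y n ≠ ⊤

/-- `λⁿ(X, Y) = 0` for `n ≪ 0`. -/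
def BoundedBelow (X Y : C) : Prop := ∀ᶠ n : ℤ in Filter.atBot, homLength φ X Y n = 0

/-- `g` is the `i`-th Hilbert polynomial of `(X, Y)`: `g(n) = λ^{dn+i}(X, Y)` for `n ≫ 0`. -/
def IsHilbertPoly (d : ℕ) (X Y : C) (i : ℕ) (g : Polynomial ℚ) : Prop :=
  ∀ᶠ n : ℤ in Filter.atTop, g.eval (n : ℚ) = (lam φ X Y (d * n + i) : ℚ)

open Classical in
/-- The `i`-th Hilbert polynomial of `(X, Y)`. It exists and is unique when `(X, Y)` satisfies
`NoethFL` and `R` is generated over `R⁰` in degree `d`. -/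
def hilbertPoly (d : ℕ) (X Y : C) (i : ℕ) : Polynomial ℚ :=
  if h : ∃ g, IsHilbertPoly φ d X Y i g then h.choose else 0

open Classical in
/-- The complexity `cx(X, Y) = 1 + max {deg gᵢ | 0 ≤ i < d}`, where `gᵢ` are the Hilbert
polynomials and the zero polynomial has degree `-1`. -/
def cx (d : ℕ) (X Y : C) : ℕ :=
  (Finset.range d).sup fun i =>
    if hilbertPoly φ d X Y i = 0 then 0 else (hilbertPoly φ d X Y i).natDegree + 1

/-- The generalized Herbrand difference
`h(X, Y)(n) = ∑_{i=0}^{d-1} (-1)^{n+i} λ^{n+i}(X, Y)`. -/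
def herbrand (d : ℕ) (X Y : C) (n : ℤ) : ℤ :=
  ∑ i ∈ Finset.range d, ((n + i).negOnePow : ℤ) * (lam φ X Y (n + i) : ℤ)

/-- The difference operator `Δ¹` of index `d`; its iterate `(diffOp d)^[s]` is `Δˢ`. -/
def diffOp (d : ℕ) (f : ℤ → ℤ) (n : ℤ) : ℤ := f (n + d) - f n

open Classical in
/-- The value `c` such that `f n = c` for all `n ≫ 0` (and `0` if there is no such value). -/
def eventualValue (f : ℤ → ℤ) : ℤ :=
  if h : ∃ c : ℤ, ∀ᶠ n : ℤ in Filter.atTop, f n = c then h.choose else 0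

/-- The Euler characteristic `∑_{n ∈ ℤ} (-1)ⁿ λⁿ(X, Y)`; the sum is finite when `λⁿ(X, Y)` is zero
for `n ≪ 0` and `cx(X, Y) = 0`. -/
def eulerChar (X Y : C) : ℤ := ∑ᶠ n : ℤ, (n.negOnePow : ℤ) * (lam φ X Y n : ℤ)

/-- The `s`-multiplicity `eˢ(X, Y)`, for `s ≥ cx(X, Y)`: for `s ≥ 1` it is the eventual value of
`Δ^{s-1} h(X, Y)`, and for `s = 0` it is the Euler characteristic. -/
def multiplicity (d : ℕ) : ℕ → C → C → ℤ
  | 0, X, Y => eulerChar φ X Y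
  | s + 1, X, Y => eventualValue ((diffOp d)^[s] (herbrand φ d X Y))

/-- `z ∈ Rᵈ` is eventually injective on `Hom*(X, Y)`: multiplication by `z` from degree `n` to
degree `n + d` is injective for `n ≫ 0`. -/
def EventuallyInjective {d : ℕ} (z : 𝒜 d) (X Y : C) : Prop :=
  ∀ᶠ n : ℤ in Filter.atTop,
    Function.Injective (act z (add_comm _ _) : HomDeg φ X Y n →+ HomDeg φ X Y (n + d))

/-- The domain of the functions `fˢ`: the pairs `(X, Y)` with `Hom*(X, Y)` in `noeth^fl(R)`,
with `λⁿ(X, Y) = 0` for `n ≪ 0`, and with `cx(X, Y) ≤ s`. -/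
structure MultDomain (d s : ℕ) (X Y : C) : Prop where
  noethFL : NoethFL φ X Y
  boundedBelow : BoundedBelow φ X Y
  cx_le : cx φ d X Y ≤ s

section Triangulated

variable [Limits.HasZeroObject C] [Pretriangulated C]

/-- `K` is a Koszul object `Y ⫽ z` of `z` on `Y`: there is a distinguished triangle
`Y ⟶ Σᵈ Y ⟶ K ⟶ Σ Y` whose first morphism is `φ_Y(z)`. -/
def IsKoszulObject {d : ℕ} (Y : C) (z : 𝒜 d) (K : C) : Prop :=
  ∃ (g : Y⟦(d : ℤ)⟧ ⟶ K) (h : K ⟶ Y⟦(1 : ℤ)⟧), Triangle.mk (φ.app z Y) g h ∈ distTriang C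

end Triangulated

/-- The axioms for a family of integer-valued functions `fˢ`, `s ≥ 0`, each defined on the pairs in
`MultDomain φ d s`; here `kos Y z` is the Koszul object `Y ⫽ z`. -/
structure MultiplicityAxioms (d : ℕ) (kos : C → 𝒜 d → C)
    (f : ∀ (s : ℕ) (X Y : C), MultDomain φ d s X Y → ℤ) : Prop where
  vanishing : ∀ (s : ℕ) (X Y : C) (h : MultDomain φ d s X Y), cx φ d X Y < s → f s X Y h = 0
  euler : ∀ (X Y : C) (h : MultDomain φ d 0 X Y), cx φ d X Y = 0 →
    f 0 X Y h = ∑ᶠ n : ℤ, (n.negOnePow : ℤ) * (lam φ X Y n : ℤ)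
  koszul : ∀ (s : ℕ) (X Y : C) (h : MultDomain φ d (s + 1) X Y), cx φ d X Y = s + 1 →
    ∀ z : 𝒜 d, EventuallyInjective φ z X Y → ∀ h' : MultDomain φ d s X (kos Y z),
      f (s + 1) X Y h = f s X (kos Y z) h'

variable (𝒜) in
/-- `R⁰` contains an infinite field, or is local with infinite residue field. -/
def ContainsInfiniteFieldOrLocal : Prop :=
  (∃ K : Subring (𝒜 0), IsField K ∧ Infinite K) ∨
    ∃ _ : IsLocalRing (𝒜 0), Infinite (IsLocalRing.ResidueField (𝒜 0))

end TriangMult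

end

/-! Everything rests on one mechanism. If `z` is eventually injective on `Hom*(X, Y)`, the long
exact sequence of the Koszul triangle breaks up in large degrees, so `λ(X, Y⫽z) = Δλ(X, Y)` there
(`IsKoszulObject.eventually_lam_eq`). As `d` is even, signs have period `d`, and `h(X, Y⫽z) = Δh(X,
Y)` eventually. Hence `eˢ⁺¹(X, Y) = eˢ(X, Y⫽z)` at once for `s ≥ 1`. For `s = 0` the alternating sum
of the lengths of `Hom*(X, Y⫽z)` telescopes to the eventual value of `h(X, Y)`
(`IsKoszulObject.eventually_herbrand_eq_eulerChar`).

Two inputs make this usable. An eventually injective `z` exists by prime avoidance in degree `d`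
(`exists_eventuallyInjective`). And `cx ≤ s` holds exactly when `Δˢλ` vanishes eventually
(`cx_le_iff`), once some iterated difference is known to vanish. That is proved by Noetherian
induction on the annihilator of `Hom*(X, Y)` in large degrees, which grows on passing to `Y⫽z`.

The axioms then determine `fˢ` by induction on `s`: either vanishing applies, or a suitable `z`
lowers `s` by one, down to the Euler characteristic. -/

noncomputable section

namespace TriangMult

/-! ### Moving shifts between source, target and degree of a morphism -/

section ShiftedHomLemmas

variable {C : Type*} [Category* C] [HasShift C ℤ]

/-- The identity of `Y⟦a⟧`, as a shifted morphism of degree `a` from `Y⟦a⟧` to `Y`. -/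
def unshift (Y : C) (a : ℤ) : ShiftedHom (Y⟦a⟧) Y a := 𝟙 _

lemma shiftedHom_comp_eq {X Y Z : C} {a n k : ℤ} (f : ShiftedHom X Y n) (g : ShiftedHom Y Z a)
    (h : a + n = k) :
    f.comp g h = (f ≫ g⟦n⟧') ≫ (shiftFunctorAdd' C a n k h).inv.app Z := by
  simp [ShiftedHom.comp]

lemma comp_unshift {X Y : C} {a n k : ℤ} (h : a + n = k) (f : ShiftedHom X (Y⟦a⟧) n) :
    f.comp (unshift Y a) h = f ≫ (shiftFunctorAdd' C a n k h).inv.app Y := by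
  simp [ShiftedHom.comp, unshift]

/-- Composing with `unshift` is composing with a coherence isomorphism, which cancels. This carries
exactness of ordinary Hom sequences over to shifted morphisms. -/
lemma comp_eq_comp_unshift_iff {X Y Z : C} {a n k : ℤ} (h : a + n = k) (f : ShiftedHom X Y n)
    (t : ShiftedHom Y Z a) (f' : ShiftedHom X (Z⟦a⟧) n) :
    f.comp t h = f'.comp (unshift Z a) h ↔ f ≫ t⟦n⟧' = f' := by
  rw [comp_unshift, shiftedHom_comp_eq, cancel_mono]

lemma exists_comp_unshift {X Y : C} {a n k : ℤ} (h : a + n = k) (f : ShiftedHom X Y k) :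
    ∃ f' : ShiftedHom X (Y⟦a⟧) n, f'.comp (unshift Y a) h = f :=
  ⟨f ≫ (shiftFunctorAdd' C a n k h).hom.app Y, by simp [comp_unshift]⟩

lemma unshift_comp {Y Z : C} {a n k : ℤ} (h : n + a = k) (f : ShiftedHom Y Z n) :
    (unshift Y a).comp f h = f⟦a⟧' ≫ (shiftFunctorAdd' C n a k h).inv.app Z := by
  simp [ShiftedHom.comp, unshift]

lemma unshift_comp_injective {Y Z : C} {a n k : ℤ} (h : n + a = k) :
    Function.Injective fun f : ShiftedHom Y Z n => (unshift Y a).comp f h := by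
  intro f g hfg
  simp only [unshift_comp] at hfg
  exact (shiftFunctor C a).map_injective ((cancel_mono _).mp hfg)

lemma exists_unshift_comp {Y Z : C} {a n k : ℤ} (h : n + a = k) (f : ShiftedHom (Y⟦a⟧) Z k) :
    ∃ f' : ShiftedHom Y Z n, (unshift Y a).comp f' h = f := by
  obtain ⟨f', hf'⟩ := (shiftFunctor C a).map_surjective
    (f ≫ (shiftFunctorAdd' C n a k h).hom.app Z)
  exact ⟨f', by rw [unshift_comp, hf']; simp⟩

end ShiftedHomLemmas

/-! ### Exactness of Hom on a shifted triangle -/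

section Triangle

variable {C : Type*} [Category* C] [Preadditive C] [Limits.HasZeroObject C] [HasShift C ℤ]
  [∀ n : ℤ, (shiftFunctor C n).Additive] [Pretriangulated C]

lemma comp_shift_map_eq_zero_iff {A B D : C} {u : A ⟶ B} {v : B ⟶ D} {w : D ⟶ A⟦(1 : ℤ)⟧}
    (hT : Triangle.mk u v w ∈ distTriang C) {X : C} {n : ℤ}
    (f : X ⟶ B⟦n⟧) :
    f ≫ v⟦n⟧' = 0 ↔ ∃ f₀ : X ⟶ A⟦n⟧, f₀ ≫ u⟦n⟧' = f := by
  constructor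
  · intro hf
    obtain ⟨f₀, hf₀⟩ : ∃ f₀ : X ⟶ A⟦n⟧, f = f₀ ≫ (n.negOnePow • u⟦n⟧') :=
      Triangle.coyoneda_exact₂ _ (Triangle.shift_distinguished _ hT n) f
      (by
        change f ≫ (n.negOnePow • v⟦n⟧') = 0
        rw [Linear.comp_units_smul, hf, smul_zero])
    -- The `n`-fold shift of a triangle is distinguished only with signs `(-1)ⁿ` on its maps; the
    -- lift absorbs the sign.
    refine ⟨n.negOnePow • f₀, ?_⟩
    rw [Linear.units_smul_comp, ← Linear.comp_units_smul]
    exact hf₀.symm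
  · rintro ⟨f₀, rfl⟩
    rw [Category.assoc, ← Functor.map_comp,
      show u ≫ v = 0 from comp_distTriang_mor_zero₁₂ _ hT, Functor.map_zero,
      Limits.comp_zero]

end Triangle

/-! ### Linearity of composition over the central action -/

section Central

variable {R : Type*} [CommRing R] {𝒜 : ℕ → AddSubgroup R} [GradedRing 𝒜]
  {C : Type*} [Category* C] [Preadditive C] [HasShift C ℤ]
  [∀ n : ℤ, (shiftFunctor C n).Additive] (φ : CentralAction 𝒜 C)

lemma CentralAction.naturality {m : ℕ} (r : 𝒜 m) {X Y : C} (f : X ⟶ Y) :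
    f ≫ φ.app r Y = φ.app r X ≫ f⟦(m : ℤ)⟧' :=
  (φ.toCenter m r).1.naturality f

/-- This is the defining relation `ηΣ = (-1)ᵐΣη` of the graded center, whose sign disappears for
even `m`. -/
lemma CentralAction.app_comp_unshift_one {m : ℕ} (hm : Even m) (r : 𝒜 m) (Y : C) {k : ℤ}
    (h : 1 + (m : ℤ) = k) (h' : (m : ℤ) + 1 = k) :
    ShiftedHom.comp (φ.app r (Y⟦(1 : ℤ)⟧)) (unshift Y 1) h =
      ShiftedHom.comp (unshift Y 1) (φ.app r Y) h' := by
  subst h'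
  have hr : φ.app r (Y⟦(1 : ℤ)⟧) =
      (m : ℤ).negOnePow • ((φ.app r Y)⟦(1 : ℤ)⟧' ≫ (shiftComm Y (m : ℤ) 1).hom) :=
    (φ.toCenter m r).2 Y
  rw [Int.negOnePow_even _ (by exact_mod_cast hm), one_smul] at hr
  rw [comp_unshift, unshift_comp, hr, Category.assoc]
  congr 1
  simp [shiftComm, shiftFunctorComm_eq C (m : ℤ) 1 (m + 1) rfl]

/-- Elements of even degree commute with shifted morphisms. -/
lemma CentralAction.app_comp {m : ℕ} (hm : Even m) (r : 𝒜 m) {a : ℤ} :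
    ∀ {W Y : C} (t : ShiftedHom W Y a) {k : ℤ} (h : a + (m : ℤ) = k) (h' : (m : ℤ) + a = k),
    ShiftedHom.comp (φ.app r W) t h = ShiftedHom.comp t (φ.app r Y) h' := by
  -- Degree `0` is naturality. Upwards, `t` factors through `Y⟦1⟧` with degree one less. Downwards,
  -- composing with `unshift W 1` is injective and raises the degree. Both steps change an object,
  -- so `W` and `Y` stay quantified.
  induction a using Int.induction_on with
  | zero =>
    intro W Y t k h h'
    obtain ⟨t, rfl⟩ := (ShiftedHom.homEquiv (0 : ℤ) rfl).surjective t
    obtain rfl : (m : ℤ) = k := by omega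
    rw [ShiftedHom.homEquiv_apply, ShiftedHom.mk₀_comp, ShiftedHom.comp_mk₀, φ.naturality]
  | succ a ih =>
    intro W Y t k h h'
    obtain ⟨t', rfl⟩ := exists_comp_unshift (a := 1) (n := a) (by ring) t
    calc ShiftedHom.comp (φ.app r W) (t'.comp (unshift Y 1) (by ring)) h
        = ShiftedHom.comp (ShiftedHom.comp (φ.app r W) t' rfl) (unshift Y 1)
            (show 1 + (a + (m : ℤ)) = k by omega) :=
          (ShiftedHom.comp_assoc _ _ _ _ _ (by omega)).symm
      _ = ShiftedHom.comp (ShiftedHom.comp t' (φ.app r (Y⟦(1 : ℤ)⟧)) (add_comm _ _))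
            (unshift Y 1) (show 1 + (a + (m : ℤ)) = k by omega) := by
          rw [ih t' rfl (add_comm _ _)]
      _ = ShiftedHom.comp t' (ShiftedHom.comp (φ.app r (Y⟦(1 : ℤ)⟧)) (unshift Y 1) rfl)
            (show 1 + (m : ℤ) + a = k by omega) :=
          ShiftedHom.comp_assoc _ _ _ _ _ (by omega)
      _ = ShiftedHom.comp t' (ShiftedHom.comp (unshift Y 1) (φ.app r Y) (add_comm _ _))
            (show 1 + (m : ℤ) + a = k by omega) := by
          rw [φ.app_comp_unshift_one hm r Y rfl (add_comm _ _)]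
      _ = _ := (ShiftedHom.comp_assoc _ _ _ _ _ (by omega)).symm
  | pred a ih =>
    intro W Y t k h h'
    apply unshift_comp_injective (a := 1) (k := k + 1) rfl
    calc (unshift W 1).comp (ShiftedHom.comp (φ.app r W) t h) rfl
        = ShiftedHom.comp (ShiftedHom.comp (unshift W 1) (φ.app r W) (add_comm _ _)) t
            (show -a - 1 + (1 + (m : ℤ)) = k + 1 by omega) :=
          (ShiftedHom.comp_assoc _ _ _ _ _ (by omega)).symm
      _ = ShiftedHom.comp (ShiftedHom.comp (φ.app r (W⟦(1 : ℤ)⟧)) (unshift W 1) rfl) t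
            (show -a - 1 + (1 + (m : ℤ)) = k + 1 by omega) := by
          rw [φ.app_comp_unshift_one hm r W rfl (add_comm _ _)]
      _ = ShiftedHom.comp (φ.app r (W⟦(1 : ℤ)⟧)) (ShiftedHom.comp (unshift W 1) t
            (show -a - 1 + 1 = -(a : ℤ) by omega)) (by omega) :=
          ShiftedHom.comp_assoc _ _ _ _ _ (by omega)
      _ = ShiftedHom.comp (ShiftedHom.comp (unshift W 1) t
            (show -a - 1 + 1 = -(a : ℤ) by omega)) (φ.app r Y) (by omega) :=
          ih _ _ _
      _ = (unshift W 1).comp (ShiftedHom.comp t (φ.app r Y) h') rfl :=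
          ShiftedHom.comp_assoc _ _ _ _ _ (by omega)

/-- Composition with a shifted morphism `t` of degree `a`, as a map on `Hom*`. -/
def post (X : C) {Y Z : C} {a : ℤ} (t : ShiftedHom Y Z a) {n k : ℤ} (h : a + n = k) :
    HomDeg φ X Y n →+ HomDeg φ X Z k where
  toFun f := ShiftedHom.comp (X := X) (Y := Y) (Z := Z) f t h
  map_zero' := ShiftedHom.zero_comp X n _ h
  map_add' f g := ShiftedHom.add_comp f g _ h

variable {φ}
variable {X Y Z : C}

lemma act_eq_post {m : ℕ} (r : 𝒜 m) {n k : ℤ} (h : (m : ℤ) + n = k) :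
    act r h = post φ X (φ.app r Y) h := rfl

lemma post_post {W : C} {a b c n k l : ℤ} (t : ShiftedHom Y Z a) (u : ShiftedHom Z W b)
    (h : a + n = k) (h' : b + k = l) (hab : b + a = c) (f : HomDeg φ X Y n) :
    post φ X u h' (post φ X t h f) = post φ X (t.comp u hab) (by omega) f :=
  ShiftedHom.comp_assoc (X := X) (Y := Y) (Z := Z) (T := W) f t u h hab (by omega)

lemma act_post {m : ℕ} (hm : Even m) (r : 𝒜 m) {a n k l j : ℤ} (t : ShiftedHom Y Z a)
    (h : a + n = k) (h' : (m : ℤ) + k = l) (h₁ : (m : ℤ) + n = j) (h₂ : a + j = l)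
    (f : HomDeg φ X Y n) :
    act r h' (post φ X t h f) = post φ X t h₂ (act r h₁ f) := by
  rw [act_eq_post, act_eq_post, post_post t _ h h' rfl, post_post _ t h₁ h₂ (add_comm _ _),
    φ.app_comp hm r t (add_comm _ _) rfl]

/-- Composition with a shifted morphism, as an `R⁰`-linear map. -/
def postLinear (X : C) {Y Z : C} {a : ℤ} (t : ShiftedHom Y Z a) {n k : ℤ} (h : a + n = k) :
    HomDeg φ X Y n →ₗ[𝒜 0] HomDeg φ X Z k where
  __ := post φ X t h
  map_smul' r f := (act_post (Even.zero) r t h (by simp) (by simp) h f).symm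

variable (φ) in
/-- Composition with a shifted morphism, as an additive map on `Hom*`. -/
def postStarAdd (X : C) {Y Z : C} {a : ℤ} (t : ShiftedHom Y Z a) :
    HomStar φ X Y →+ HomStar φ X Z :=
  DirectSum.toAddMonoid (β := HomDeg φ X Y) fun n : ℤ =>
    (HomStar.of φ X Z (a + n)).comp (post φ X t rfl)

lemma postStarAdd_of {a n k : ℤ} (t : ShiftedHom Y Z a) (h : a + n = k) (f : HomDeg φ X Y n) :
    postStarAdd φ X t (HomStar.of φ X Y n f) = HomStar.of φ X Z k (post φ X t h f) := by
  subst h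
  exact DirectSum.toAddMonoid_of (β := HomDeg φ X Y) _ n f

/-- Composition with a shifted morphism, as an `R`-linear map on `Hom*`, when `R` lives in even
degrees. -/
def postStar (heven : ∀ m, ¬ Even m → ∀ r : 𝒜 m, r = 0) (φ : CentralAction 𝒜 C) (X : C) {Y Z : C}
    {a : ℤ} (t : ShiftedHom Y Z a) : HomStar φ X Y →ₗ[R] HomStar φ X Z where
  __ := postStarAdd φ X t
  map_smul' r x := by
    change postStarAdd φ X t (r • x) = r • postStarAdd φ X t x
    induction x using homStar_induction with
    | zero => rw [smul_zero, map_zero, smul_zero]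
    | add x y hx hy => rw [smul_add, map_add, map_add, hx, hy, smul_add]
    | of n f =>
      induction r using DirectSum.Decomposition.inductionOn 𝒜 with
      | zero => rw [zero_smul, map_zero, zero_smul]
      | add r s hr hs => rw [add_smul, map_add, hr, hs, add_smul]
      | homogeneous r =>
        rename_i m
        by_cases hm : Even m
        · rw [smul_of r rfl, postStarAdd_of t rfl, postStarAdd_of t rfl,
            smul_of r (k := a + (m + n)) (by ring), act_post hm r t rfl _ rfl rfl]
        · rw [heven m hm r]
          simp

lemma postStar_of (heven : ∀ m, ¬ Even m → ∀ r : 𝒜 m, r = 0) {a n k : ℤ} (t : ShiftedHom Y Z a)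
    (h : a + n = k) (f : HomDeg φ X Y n) :
    postStar heven φ X t (HomStar.of φ X Y n f) = HomStar.of φ X Z k (post φ X t h f) :=
  postStarAdd_of t h f

end Central

/-! ### Lengths in the long exact sequence -/

section Length

variable {R : Type*} [CommRing R] {𝒜 : ℕ → AddSubgroup R} [GradedRing 𝒜]
  {C : Type*} [Category* C] [Preadditive C] [HasShift C ℤ]
  [∀ n : ℤ, (shiftFunctor C n).Additive] {φ : CentralAction 𝒜 C}

/-- Here `κ`, `ρ` and `c` are the lengths of the kernel, image and cokernel of multiplication by
`z`; exactness identifies the cokernel with the range of `γ`, and the range of `δ` with the next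
kernel. Additivity of length in `ℕ∞` needs no finiteness. -/
lemma exists_homLength_eq {d : ℕ} {X Y K : C} {z : 𝒜 d}
    {γ : ShiftedHom Y K (-d : ℤ)} {δ : ShiftedHom K Y (1 : ℤ)}
    (h₁ : ∀ (n k : ℤ) (h : (d : ℤ) + n = k) (h' : -d + k = n),
        Function.Exact (act z h : HomDeg φ X Y n →+ _) (post φ X γ h'))
    (h₂ : ∀ (n k l : ℤ) (h : -d + k = n) (h' : 1 + n = l),
        Function.Exact (post φ X γ h) (post φ X δ h'))
    (h₃ : ∀ (n k l : ℤ) (h : 1 + n = k) (h' : (d : ℤ) + k = l),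
        Function.Exact (post φ X δ h) (act z h' : HomDeg φ X Y k →+ _)) :
    ∃ κ ρ c : ℤ → ℕ∞, ∀ n,
      homLength φ X Y n = κ n + ρ n ∧ homLength φ X Y (n + d) = ρ n + c n ∧
      homLength φ X K n = c n + κ (n + 1) ∧
      (Function.Injective (act z (add_comm _ _) : HomDeg φ X Y n →+ HomDeg φ X Y (n + d)) →
        κ n = 0) := by
  let Z (n : ℤ) : HomDeg φ X Y n →ₗ[𝒜 0] HomDeg φ X Y (n + d) :=
    postLinear X (φ.app z Y) (add_comm _ _)
  let G (n : ℤ) : HomDeg φ X Y (n + d) →ₗ[𝒜 0] HomDeg φ X K n :=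
    postLinear X γ (by ring)
  let D (n : ℤ) : HomDeg φ X K n →ₗ[𝒜 0] HomDeg φ X Y (n + 1) :=
    postLinear X δ (add_comm _ _)
  have e₁ (n : ℤ) : Function.Exact (Z n) (G n) := h₁ n _ _ _
  have e₂ (n : ℤ) : Function.Exact (G n) (D n) := h₂ n _ _ _ _
  have e₃ (n : ℤ) : Function.Exact (D n) (Z (n + 1)) := h₃ n _ _ _ _
  have rank_nullity {A : Type _} [Ring A] {M N : Type _} [AddCommGroup M] [Module A M]
      [AddCommGroup N] [Module A N] (f : M →ₗ[A] N) :
      Module.length A M = Module.length A (LinearMap.ker f) + Module.length A (LinearMap.range f) :=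
    Module.length_eq_add_of_exact (LinearMap.ker f).subtype f.rangeRestrict
      (Submodule.subtype_injective _) f.surjective_rangeRestrict
      (by rw [LinearMap.exact_iff]; simp)
  refine ⟨fun n => Module.length (𝒜 0) (LinearMap.ker (Z n)),
    fun n => Module.length (𝒜 0) (LinearMap.range (Z n)),
    fun n => Module.length (𝒜 0) (LinearMap.range (G n)), fun n => ⟨?_, ?_, ?_, ?_⟩⟩
  · exact rank_nullity (Z n)
  · exact (rank_nullity (G n)).trans (by rw [(LinearMap.exact_iff.mp (e₁ n))])
  · refine (rank_nullity (D n)).trans ?_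
    rw [LinearMap.exact_iff.mp (e₂ n), ← LinearMap.exact_iff.mp (e₃ n)]
  · intro hz
    have : LinearMap.ker (Z n) = ⊥ := LinearMap.ker_eq_bot.mpr hz
    change Module.length (𝒜 0) (LinearMap.ker (Z n)) = 0
    rw [this]
    simp

end Length

/-! ### The long exact sequence of a Koszul object -/

section Koszul

variable {R : Type*} [CommRing R] {𝒜 : ℕ → AddSubgroup R} [GradedRing 𝒜]
  {C : Type*} [Category* C] [Preadditive C] [Limits.HasZeroObject C] [HasShift C ℤ]
  [∀ n : ℤ, (shiftFunctor C n).Additive] [Pretriangulated C] {φ : CentralAction 𝒜 C}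

/-- The exact sequences attached to a Koszul object, in terms of shifted morphisms. -/
lemma IsKoszulObject.exists_exact {d : ℕ} (hd : Even d) {Y K : C} {z : 𝒜 d}
    (hK : IsKoszulObject φ Y z K) :
    ∃ (γ : ShiftedHom Y K (-d : ℤ)) (δ : ShiftedHom K Y (1 : ℤ)),
      (∀ (X : C) (n k : ℤ) (h : (d : ℤ) + n = k) (h' : -d + k = n),
        Function.Exact (act z h : HomDeg φ X Y n →+ _) (post φ X γ h')) ∧
      (∀ (X : C) (n k l : ℤ) (h : -d + k = n) (h' : 1 + n = l),
        Function.Exact (post φ X γ h) (post φ X δ h')) ∧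
      (∀ (X : C) (n k l : ℤ) (h : 1 + n = k) (h' : (d : ℤ) + k = l),
        Function.Exact (post φ X δ h) (act z h' : HomDeg φ X Y k →+ _)) ∧
      (∀ (X : C) (n k : ℤ) (h : -d + n = k) (f : HomDeg φ X Y n) (l : ℤ) (h' : (d : ℤ) + k = l),
        act z h' (post φ X γ h f) = 0) := by
  obtain ⟨g, δ, hT⟩ := hK
  -- `γ` is the triangle map `g : Y⟦d⟧ ⟶ K` read as a morphism of degree `-d` out of `Y`.
  obtain ⟨γ, hγ⟩ := exists_unshift_comp (a := d) (n := -d) (k := 0) (by ring)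
    (ShiftedHom.mk₀ (0 : ℤ) rfl g)
  have hγ' (X : C) (n k : ℤ) (h : (d : ℤ) + n = k) (h' : -d + k = n)
      (f : ShiftedHom X (Y⟦(d : ℤ)⟧) n) :
      (f.comp (unshift Y d) h).comp γ h' = f ≫ g⟦n⟧' := by
    rw [← ShiftedHom.comp_mk₀ f 0 rfl g, ← hγ]
    exact ShiftedHom.comp_assoc _ _ _ _ _ (by omega)
  have hz : (φ.app z Y) ≫ g = 0 := comp_distTriang_mor_zero₁₂ _ hT
  have hT₁ : Triangle.mk g δ (-(φ.app z Y)⟦(1 : ℤ)⟧') ∈ distTriang C := rot_of_distTriang _ hT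
  have hT₂ : Triangle.mk δ (-(φ.app z Y)⟦(1 : ℤ)⟧') (-g⟦(1 : ℤ)⟧') ∈ distTriang C :=
    rot_of_distTriang _ hT₁
  refine ⟨γ, δ, ?_, ?_, ?_, ?_⟩
  · intro X n k h h' f
    obtain ⟨f, rfl⟩ := exists_comp_unshift h f
    refine (Eq.congr_left (hγ' X n k h h' f)).trans
      ((comp_shift_map_eq_zero_iff hT f).trans (exists_congr fun f₀ => ?_))
    exact (comp_eq_comp_unshift_iff h f₀ (φ.app z Y) f).symm
  · intro X n k l h h' (w : ShiftedHom X K n)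
    have h1 : (post φ X δ h' w = 0) ↔ w ≫ δ⟦n⟧' = 0 := by
      change ShiftedHom.comp (X := X) (Y := K) (Z := Y) w δ h' = 0 ↔ _
      rw [shiftedHom_comp_eq, ← cancel_mono ((shiftFunctorAdd' C 1 n l h').inv.app Y),
        Limits.zero_comp]
    refine h1.trans ((comp_shift_map_eq_zero_iff hT₁ w).trans ?_)
    constructor
    · rintro ⟨f, hf⟩
      refine ⟨ShiftedHom.comp (X := X) f (unshift Y d) (by omega), ?_⟩
      exact (hγ' X n k (by omega) h f).trans hf
    · rintro ⟨f, hf⟩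
      obtain ⟨f, rfl⟩ := exists_comp_unshift (a := d) (n := n) (by omega) f
      exact ⟨f, (hγ' X n k (by omega) h f).symm.trans hf⟩
  · intro X n k l h h' v
    obtain ⟨v, rfl⟩ := exists_comp_unshift h v
    have h1 : act (φ := φ) z h' (ShiftedHom.comp (X := X) v (unshift Y 1) h) =
        (v ≫ (φ.app z Y)⟦(1 : ℤ)⟧'⟦n⟧') ≫
          ((shiftFunctorAdd' C (d : ℤ) 1 (d + 1) rfl).inv.app Y)⟦n⟧' ≫
          (shiftFunctorAdd' C ((d : ℤ) + 1) n l (by omega)).inv.app Y := by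
      refine (ShiftedHom.comp_assoc (X := X) v (unshift Y 1) (φ.app z Y) _ rfl (by omega)).trans ?_
      simp [ShiftedHom.comp, unshift]
    rw [h1]
    have h2 := comp_shift_map_eq_zero_iff hT₂ v
    have h3 : v ≫ (-(φ.app z Y)⟦(1 : ℤ)⟧')⟦n⟧' = 0 ↔
        (v ≫ (φ.app z Y)⟦(1 : ℤ)⟧'⟦n⟧') ≫
          ((shiftFunctorAdd' C (d : ℤ) 1 (d + 1) rfl).inv.app Y)⟦n⟧' ≫
          (shiftFunctorAdd' C ((d : ℤ) + 1) n l (by omega)).inv.app Y = 0 := by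
      rw [Functor.map_neg, Preadditive.comp_neg, neg_eq_zero]
      refine ⟨fun h => by rw [h, Limits.zero_comp], fun h => ?_⟩
      rwa [← Limits.zero_comp, cancel_mono] at h
    refine h3.symm.trans (h2.trans (exists_congr fun w => ?_))
    exact (comp_eq_comp_unshift_iff h w δ v).symm
  · intro X n k h f l h'
    -- By naturality `φ_K(z) ∘ g` is `g⟦d⟧` after `φ(z)` on `Y⟦d⟧`. Since `d` is even, the latter is
    -- `φ_Y(z)⟦d⟧`, so the composite is a shift of two consecutive maps of the triangle.
    have h1 : ShiftedHom.comp γ (φ.app z K) (add_neg_cancel (d : ℤ)) = 0 := by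
      apply unshift_comp_injective (a := d) (k := d) (by ring)
      have h2 : φ.app z (Y⟦(d : ℤ)⟧) = (φ.app z Y)⟦(d : ℤ)⟧' := by
        have := φ.app_comp hd z (unshift Y d) rfl rfl
        rwa [comp_unshift, unshift_comp, cancel_mono] at this
      calc ShiftedHom.comp (unshift Y d) (ShiftedHom.comp γ (φ.app z K) (add_neg_cancel (d : ℤ))) _
          = ShiftedHom.comp (ShiftedHom.comp (unshift Y d) γ (neg_add_cancel (d : ℤ)))
              (φ.app z K) (add_zero _) := (ShiftedHom.comp_assoc _ _ _ _ _ (by omega)).symm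
        _ = 0 := by
          rw [hγ, ShiftedHom.mk₀_comp, φ.naturality, h2, ← Functor.map_comp, hz, Functor.map_zero]
        _ = _ := by simp
    refine (post_post γ (φ.app z K) h h' (add_neg_cancel (d : ℤ)) f).trans ?_
    rw [h1]
    exact ShiftedHom.comp_zero (X := X) (Y := Y) K f _

end Koszul

/-! ### Rings generated in degree `d`, and homogeneous prime avoidance -/

section GradedRing

variable {R : Type*} [CommRing R] {𝒜 : ℕ → AddSubgroup R} [GradedRing 𝒜] {d : ℕ}

/-- Products of elements of `Rᵈ` span `R` over `R⁰`, and a product of `k` of them lies both in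
degree `kd` and in the `k`-th power of the ideal. -/
lemma decompose_of_adjoin_eq_top (hd : 0 < d) (hgen : Algebra.adjoin (𝒜 0) (𝒜 d : Set R) = ⊤) (r : R) :
    (∀ k, (DirectSum.decompose 𝒜 r (k * d) : R) ∈ Ideal.span (𝒜 d : Set R) ^ k) ∧
      ∀ j, ¬ d ∣ j → (DirectSum.decompose 𝒜 r j : R) = 0 := by
  have hr : r ∈ Submodule.span (𝒜 0) (Submonoid.closure (𝒜 d : Set R) : Set R) := by
    rw [← Algebra.adjoin_eq_span, hgen]
    trivial
  have key (x : R) (hx : x ∈ Submonoid.closure (𝒜 d : Set R)) :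
      ∃ k, x ∈ 𝒜 (k * d) ∧ x ∈ Ideal.span (𝒜 d : Set R) ^ k := by
    induction hx using Submonoid.closure_induction with
    | mem x hx => exact ⟨1, by simpa using hx, by simpa using Ideal.subset_span hx⟩
    | one => exact ⟨0, by simpa using SetLike.one_mem_graded 𝒜, by simp⟩
    | mul x y _ _ hx hy =>
      obtain ⟨k, hk, hk'⟩ := hx
      obtain ⟨l, hl, hl'⟩ := hy
      exact ⟨k + l, by simpa [add_mul] using SetLike.mul_mem_graded hk hl,
        by simpa [pow_add] using Ideal.mul_mem_mul hk' hl'⟩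
  induction hr using Submodule.span_induction with
  | zero => simp
  | add x y _ _ hx hy =>
    refine ⟨fun k => ?_, fun j hj => ?_⟩
    · rw [DirectSum.decompose_add, DirectSum.add_apply, AddMemClass.coe_add]
      exact add_mem (hx.1 k) (hy.1 k)
    · rw [DirectSum.decompose_add, DirectSum.add_apply, AddMemClass.coe_add, hx.2 j hj, hy.2 j hj,
        add_zero]
  | smul a x _ hx =>
    have hmul (j : ℕ) : (DirectSum.decompose 𝒜 (a • x) j : R) =
        a * (DirectSum.decompose 𝒜 x j : R) := by
      have := DirectSum.coe_decompose_mul_add_of_left_mem 𝒜 (i := 0) (j := j) (b := x) a.2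
      rwa [zero_add] at this
    refine ⟨fun k => ?_, fun j hj => ?_⟩
    · rw [hmul]
      exact Ideal.mul_mem_left _ _ (hx.1 k)
    · rw [hmul, hx.2 j hj, mul_zero]
  | mem x hx =>
    obtain ⟨k, hk, hk'⟩ := key x hx
    refine ⟨fun l => ?_, fun j hj => DirectSum.decompose_of_mem_ne 𝒜 hk ?_⟩
    · by_cases hl : k * d = l * d
      · rw [← hl, DirectSum.decompose_of_mem_same 𝒜 hk]
        rwa [← Nat.eq_of_mul_eq_mul_right hd hl]
      · rw [DirectSum.decompose_of_mem_ne 𝒜 hk hl]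
        exact zero_mem _
    · rintro rfl
      exact hj (Dvd.intro_left _ rfl)

lemma eq_zero_of_not_even (hd : 0 < d) (hde : Even d) (hgen : Algebra.adjoin (𝒜 0) (𝒜 d : Set R) = ⊤) (m : ℕ)
    (hm : ¬ Even m) (r : 𝒜 m) : r = 0 := by
  have := (decompose_of_adjoin_eq_top hd hgen (r : R)).2 m
    fun h => hm (hde.trans_dvd h)
  rw [DirectSum.decompose_of_mem_same 𝒜 r.2] at this
  exact Subtype.ext this

lemma mem_span_pow (hd : 0 < d) (hgen : Algebra.adjoin (𝒜 0) (𝒜 d : Set R) = ⊤) {m k : ℕ} {r : R}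
    (hr : r ∈ 𝒜 m) (hm : k * d ≤ m) : r ∈ Ideal.span (𝒜 d : Set R) ^ k := by
  rw [← DirectSum.decompose_of_mem_same 𝒜 hr]
  by_cases h : d ∣ m
  · obtain ⟨l, rfl⟩ := h
    rw [mul_comm d l]
    rw [mul_comm d l] at hm
    exact Ideal.pow_le_pow_right (Nat.le_of_mul_le_mul_right hm hd)
      ((decompose_of_adjoin_eq_top hd hgen r).1 l)
  · rw [(decompose_of_adjoin_eq_top hd hgen r).2 m h]
    exact zero_mem _

/-- The set is the given field, or one lift of each residue class. Unit differences are all that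
prime avoidance needs, so both hypotheses on `R⁰` merge here. -/
lemma exists_infinite_isUnit_sub (h : ContainsInfiniteFieldOrLocal 𝒜) :
    ∃ S : Set (𝒜 0), S.Infinite ∧ ∀ s ∈ S, ∀ t ∈ S, s ≠ t → IsUnit (s - t) := by
  rcases h with ⟨K, hK, hinf⟩ | ⟨hloc, hinf⟩
  · refine ⟨K, Set.infinite_coe_iff.mp hinf, fun s hs t ht hst => ?_⟩
    obtain ⟨b, hb⟩ := hK.mul_inv_cancel (a := ⟨s, hs⟩ - ⟨t, ht⟩)
      (sub_ne_zero.mpr fun h => hst (congrArg Subtype.val h))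
    exact IsUnit.of_mul_eq_one (b : 𝒜 0) (congrArg Subtype.val hb)
  · refine ⟨Set.range (Function.surjInv (IsLocalRing.residue_surjective (R := 𝒜 0))),
      Set.infinite_range_of_injective (Function.injective_surjInv _), ?_⟩
    rintro _ ⟨a, rfl⟩ _ ⟨b, rfl⟩ hab
    have hres := Function.surjInv_eq (IsLocalRing.residue_surjective (R := 𝒜 0))
    rw [← IsLocalRing.residue_ne_zero_iff_isUnit, map_sub, hres, hres, sub_ne_zero]
    exact fun h => hab (congrArg _ h)

/-- Prime avoidance in the homogeneous component of degree `d`. -/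
lemma exists_notMem_of_finite (h : ContainsInfiniteFieldOrLocal 𝒜) {P : Set (Ideal R)}
    (hP : P.Finite) (hPd : ∀ p ∈ P, ¬ (𝒜 d : Set R) ⊆ p) : ∃ z : 𝒜 d, ∀ p ∈ P, (z : R) ∉ p := by
  obtain ⟨S, hS, hS'⟩ := exists_infinite_isUnit_sub h
  induction P, hP using Set.Finite.induction_on with
  | empty => exact ⟨0, by simp⟩
  | @insert p P _ hfin ih =>
    obtain ⟨z, hz⟩ := ih fun q hq => hPd q (Set.mem_insert_of_mem _ hq)
    obtain ⟨w, hw, hwp⟩ := Set.not_subset.mp (hPd p (Set.mem_insert _ _))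
    -- Two bad scalars for the same `q` would put a unit multiple of `w`, hence `w`, in `q`. That is
    -- excluded for `q = p` by the choice of `w`; for the other `q` it would force `z ∈ q`.
    have hbad (q : Ideal R) (hq : q ∈ insert p P) :
        {s ∈ S | (z : R) + s * w ∈ q}.Subsingleton := by
      rintro s ⟨hs, hsq⟩ t ⟨ht, htq⟩
      by_contra hst
      have hwq : w ∈ q := by
        have h1 : ((s - t : 𝒜 0) : R) * w ∈ q := by
          have := sub_mem hsq htq
          rwa [add_sub_add_left_eq_sub, ← sub_mul] at this
        exact (Ideal.unit_mul_mem_iff_mem q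
          ((hS' s hs t ht hst).map (SetLike.GradeZero.subring 𝒜).subtype)).mp h1
      rcases hq with rfl | hq
      · exact hwp hwq
      · exact hz q hq ((Ideal.add_mem_iff_left q (Ideal.mul_mem_left _ _ hwq)).mp hsq)
    obtain ⟨s, hsS, hs⟩ := (hS.sdiff
      ((hfin.insert p).biUnion fun q hq => (hbad q hq).finite)).nonempty
    have hmem : (z : R) + s * w ∈ 𝒜 d := by
      have := SetLike.mul_mem_graded s.2 (show w ∈ 𝒜 d from hw)
      rw [zero_add] at this
      exact add_mem z.2 this
    exact ⟨⟨_, hmem⟩, fun q hq hzq => hs (Set.mem_biUnion hq ⟨hsS, hzq⟩)⟩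

end GradedRing

/-! ### Zero divisors modulo power torsion -/

section Torsion

variable {R : Type*} [CommRing R] [IsNoetherianRing R] {M : Type*} [AddCommGroup M] [Module R M]
  [IsNoetherian R M]

/-- The chain of `Jᵏ`-torsion submodules stabilizes at some `F m`, and `P` is the set of associated
primes of `M ⧸ F m`. If one of them contained `J`, it would be the annihilator of the class of some
`x` with `Jx ⊆ F m`, so `x ∈ F (m + 1) = F m`, which is absurd. An element outside `P` is a
nonzerodivisor on `M ⧸ F m`. -/
lemma exists_smul_eq_zero_imp (J : Ideal R) :
    ∃ (m : ℕ) (P : Set (Ideal R)), P.Finite ∧ (∀ p ∈ P, ¬ J ≤ p) ∧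
      ∀ z : R, (∀ p ∈ P, z ∉ p) → ∀ x : M, z • x = 0 → ∀ r ∈ J ^ m, r • x = 0 := by
  let F : ℕ →o Submodule R M := ⟨fun k => Submodule.torsionBySet R M (J ^ k : Ideal R),
    fun k l hkl => Submodule.torsionBySet_le_torsionBySet_of_subset (Ideal.pow_le_pow_right hkl)⟩
  obtain ⟨m, hm⟩ := monotone_stabilizes_iff_noetherian.mpr ‹IsNoetherian R M› F
  refine ⟨m, associatedPrimes R (M ⧸ F m), associatedPrimes.finite R _, ?_, ?_⟩
  · intro p hp hJ
    obtain ⟨hp, x, rfl⟩ := isAssociatedPrime_iff.mp hp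
    obtain ⟨x, rfl⟩ := Submodule.mkQ_surjective _ x
    apply hp.ne_top
    have hx : x ∈ F m := by
      rw [hm (m + 1) (Nat.le_succ m)]
      refine (Submodule.mem_torsionBySet_iff _ _).mpr ?_
      suffices ∀ a ∈ J ^ m * J, a • x = 0 from fun ⟨a, ha⟩ => this a (pow_succ J m ▸ ha)
      intro a ha
      refine Submodule.mul_induction_on ha (fun b hb c hc => ?_) fun b c hb hc => ?_
      · have := hJ hc
        rw [Submodule.mem_colon_singleton, Submodule.mem_bot, ← map_smul, Submodule.mkQ_apply,
          Submodule.Quotient.mk_eq_zero] at this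
        rw [mul_smul]
        exact (Submodule.mem_torsionBySet_iff _ _).mp this ⟨b, hb⟩
      · rw [add_smul, hb, hc, add_zero]
    rw [Submodule.mkQ_apply, (Submodule.Quotient.mk_eq_zero _).mpr hx]
    simp
  · intro z hz x hx r hr
    have hxF : x ∈ F m := by
      by_contra hxF
      have hmem : z ∈ ⋃ p ∈ associatedPrimes R (M ⧸ F m), (p : Set R) := by
        rw [biUnion_associatedPrimes_eq_zero_divisors]
        refine ⟨(F m).mkQ x, ?_, ?_⟩
        · simpa [Submodule.Quotient.mk_eq_zero] using hxF
        · rw [← map_smul, hx, map_zero]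
      obtain ⟨p, hp, hzp⟩ := Set.mem_iUnion₂.mp hmem
      exact hz p hp hzp
    exact (Submodule.mem_torsionBySet_iff _ _).mp hxF ⟨r, hr⟩

end Torsion

/-! ### Existence of eventually injective elements -/

section EventuallyInjective

variable {R : Type*} [CommRing R] {𝒜 : ℕ → AddSubgroup R} [GradedRing 𝒜]
  {C : Type*} [Category* C] [Preadditive C] [HasShift C ℤ]
  [∀ n : ℤ, (shiftFunctor C n).Additive] {φ : CentralAction 𝒜 C} {X Y : C}

lemma of_mem_homGE {n₀ n : ℤ} (hn : n₀ ≤ n) (f : HomDeg φ X Y n) :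
    HomStar.of φ X Y n f ∈ HomGE φ X Y n₀ :=
  fun k hk => coeff_of_ne (by omega) f

lemma of_injective (n : ℤ) : Function.Injective (HomStar.of φ X Y n) :=
  DirectSum.of_injective n

lemma exists_forall_coeff_eq_zero (x : HomStar φ X Y) :
    ∃ N : ℤ, ∀ n, N ≤ n → HomStar.coeff n x = 0 := by
  induction x using homStar_induction with
  | zero => exact ⟨0, fun n _ => map_zero _⟩
  | of k f => exact ⟨k + 1, fun n hn => coeff_of_ne (by omega) f⟩
  | add x y hx hy =>
    obtain ⟨N, hN⟩ := hx
    obtain ⟨N', hN'⟩ := hy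
    refine ⟨max N N', fun n hn => ?_⟩
    rw [map_add, hN n (by omega), hN' n (by omega), add_zero]

/-- Finitely generated submodules killed by a power of the ideal generated by `Rᵈ` are bounded
above. -/
lemma exists_forall_coeff_eq_zero_of_fg {d : ℕ} (hd : 0 < d)
    (hgen : Algebra.adjoin (𝒜 0) (𝒜 d : Set R) = ⊤) {m : ℕ} {N : Submodule R (HomStar φ X Y)}
    (hN : N.FG) (hm : ∀ x ∈ N, ∀ r ∈ Ideal.span (𝒜 d : Set R) ^ m, r • x = 0) :
    ∃ b : ℤ, ∀ x ∈ N, ∀ n, b ≤ n → HomStar.coeff n x = 0 := by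
  obtain ⟨s, rfl⟩ := hN
  choose B hB using fun x : HomStar φ X Y => exists_forall_coeff_eq_zero x
  obtain ⟨b, hb⟩ := (s.image B).bddAbove
  -- The generators vanish from degree `b` on. A multiplier of degree at least `md` kills them, and
  -- one of smaller degree moves them by less than `md`.
  refine ⟨b + m * d, fun x hx => ?_⟩
  induction hx using Submodule.closure_induction with
  | zero => exact fun n _ => map_zero _
  | add x y _ _ hx hy =>
    intro n hn
    rw [map_add, hx n hn, hy n hn, add_zero]
  | smul_mem r x hx =>
    intro n hn
    induction r using DirectSum.Decomposition.inductionOn 𝒜 with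
    | zero => rw [zero_smul, map_zero]
    | add r s hr hs => rw [add_smul, map_add, hr, hs, add_zero]
    | homogeneous r =>
      rename_i j
      by_cases hj : m * d ≤ j
      · rw [hm x (Submodule.subset_span hx) r (mem_span_pow hd hgen r.2 hj), map_zero]
      · have hbx : B x ≤ b := hb (Finset.mem_coe.mpr (Finset.mem_image_of_mem B hx))
        have hj' : (j : ℤ) ≤ m * d := by exact_mod_cast (not_le.mp hj).le
        rw [coeff_smul r (n := n - j) (by ring), hB x _ (by omega), map_zero]

/-- For `z` avoiding the relevant primes, its kernel on a Noetherian truncation is finitely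
generated and killed by a power of the ideal generated by `Rᵈ`, hence bounded above. -/
theorem exists_eventuallyInjective [IsNoetherianRing R] {d : ℕ} (hd : 0 < d)
    (hgen : Algebra.adjoin (𝒜 0) (𝒜 d : Set R) = ⊤) (h : ContainsInfiniteFieldOrLocal 𝒜)
    (hXY : NoethFL φ X Y) : ∃ z : 𝒜 d, EventuallyInjective φ z X Y := by
  obtain ⟨n₀, hn₀⟩ := hXY.eventually_noetherian
  obtain ⟨m, P, hP, hPJ, hPz⟩ :=
    exists_smul_eq_zero_imp (M := HomGE φ X Y n₀) (Ideal.span (𝒜 d : Set R))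
  obtain ⟨z, hz⟩ := exists_notMem_of_finite (d := d) h hP
    fun p hp hdp => hPJ p hp (Ideal.span_le.mpr hdp)
  let N : Submodule R (HomGE φ X Y n₀) := LinearMap.ker (LinearMap.lsmul R _ (z : R))
  obtain ⟨b, hb⟩ := exists_forall_coeff_eq_zero_of_fg (φ := φ) (X := X) (Y := Y) hd hgen (m := m)
    (N := N.map (HomGE φ X Y n₀).subtype) ((IsNoetherian.noetherian N).map _) (by
      rintro _ ⟨x, hx, rfl⟩ r hr
      have := hPz z hz x hx r hr
      rw [← map_smul, this, map_zero])
  refine ⟨z, Filter.eventually_atTop.mpr ⟨max b n₀, fun n hn => ?_⟩⟩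
  rw [injective_iff_map_eq_zero]
  intro f hf
  have := hb (HomStar.of φ X Y n f) ⟨⟨_, of_mem_homGE (n₀ := n₀) (by omega) f⟩, ?_, rfl⟩ n (by omega)
  · rwa [coeff_of_same] at this
  · refine LinearMap.mem_ker.mpr (Subtype.ext ?_)
    change (z : R) • HomStar.of φ X Y n f = 0
    rw [smul_of z (add_comm _ _), hf, map_zero]

end EventuallyInjective

open Filter Polynomial

/-! ### Iterated differences and polynomials on residue classes -/

section DiffOp

variable {d : ℕ}

lemma diffOp_eq_fwdDiff (d : ℕ) : diffOp d = fwdDiff (d : ℤ) := rfl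

lemma diffOp_iterate_congr {F G : ℤ → ℤ} (h : ∀ᶠ n in atTop, F n = G n) (s : ℕ) :
    ∀ᶠ n in atTop, (diffOp d)^[s] F n = (diffOp d)^[s] G n := by
  induction s with
  | zero => exact h
  | succ s ih =>
    have hd := (tendsto_atTop_add_const_right atTop (d : ℤ) tendsto_id).eventually ih
    filter_upwards [ih, hd] with n h₁ h₂
    simp only [Function.iterate_succ_apply', diffOp]
    rw [h₁, show (diffOp d)^[s] F (n + d) = _ from h₂]
    rfl

/-- Newton's forward difference formula with step `d`, based at `y = dM + i`. -/
lemma exists_polynomial_of_diffOp_iterate (hd : 0 < d) {F : ℤ → ℤ} {s : ℕ}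
    (h : ∀ᶠ n in atTop, (diffOp d)^[s] F n = 0) (i : ℕ) :
    ∃ g : ℚ[X], g.degree < s ∧ ∀ᶠ n : ℤ in atTop, g.eval (n : ℚ) = (F (d * n + i) : ℚ) := by
  obtain ⟨N, hN⟩ := eventually_atTop.mp h
  have hzero (j : ℕ) (n : ℤ) (hn : N ≤ n) : (diffOp d)^[s + j] F n = 0 := by
    rw [add_comm, Function.iterate_add_apply, diffOp_eq_fwdDiff, fwdDiff_iter_eq_sum_shift,
      ← diffOp_eq_fwdDiff]
    refine Finset.sum_eq_zero fun k _ => ?_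
    rw [hN _ (by simp only [nsmul_eq_mul]; nlinarith [Int.natCast_nonneg k, Int.natCast_nonneg d]), smul_zero]
  -- Nonnegativity of `M` gives `dM + i ≥ M ≥ N`, so all differences of order at least `s` vanish at
  -- the base point.
  set M : ℤ := max N 0 with hM
  set y : ℤ := d * M + i with hy
  have hNy : N ≤ y := by
    have h1 : (1 : ℤ) ≤ d := by exact_mod_cast hd
    nlinarith [le_max_left N 0, le_max_right N 0]
  refine ⟨∑ k ∈ Finset.range s, (((diffOp d)^[k] F y : ℚ) / k.factorial) •
    (descPochhammer ℚ k).comp (X - C (M : ℚ)), ?_, ?_⟩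
  · rw [← mem_degreeLT]
    refine Submodule.sum_mem _ fun k hk => Submodule.smul_mem _ _ (mem_degreeLT.mpr ?_)
    refine degree_le_natDegree.trans_lt ?_
    rw [natDegree_comp, descPochhammer_natDegree, natDegree_X_sub_C, mul_one]
    exact_mod_cast Finset.mem_range.mp hk
  · refine eventually_atTop.mpr ⟨M, fun n hn => ?_⟩
    obtain ⟨m, rfl⟩ := Int.le.dest hn
    have key : F (d * (M + m) + i) =
        ∑ k ∈ Finset.range s, (m.choose k : ℤ) * (diffOp d)^[k] F y := by
      rw [show (d : ℤ) * (M + m) + i = y + m • (d : ℤ) by rw [nsmul_eq_mul, hy]; ring,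
        shift_eq_sum_fwdDiff_iter (d : ℤ) F m y, ← diffOp_eq_fwdDiff]
      simp only [nsmul_eq_mul]
      -- Newton's sum stops at `m`, the polynomial's at `s - 1`: the excess terms vanish through the
      -- binomials in one case, through the differences in the other.
      rcases le_total (m + 1) s with hms | hms
      · refine Finset.sum_subset (Finset.range_mono hms) fun k _ hk => ?_
        rw [Nat.choose_eq_zero_of_lt (by simpa using hk), Nat.cast_zero, zero_mul]
      · refine (Finset.sum_subset (Finset.range_mono hms) fun k _ hk => ?_).symm
        obtain ⟨j, rfl⟩ := Nat.exists_eq_add_of_le (not_lt.mp (mt Finset.mem_range.mpr hk))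
        rw [hzero j y hNy, mul_zero]
    rw [key, eval_finsetSum]
    push_cast
    refine Finset.sum_congr rfl fun k _ => ?_
    rw [eval_smul, eval_comp, Nat.cast_choose_eq_descPochhammer_div ℚ]
    simp only [eval_sub, eval_X, eval_C, add_sub_cancel_left, smul_eq_mul]
    ring

/-- On each residue class modulo `d`, `Δ` becomes the unit-step difference of `g i`, and `s` of
these kill degree below `s`. -/
lemma eventually_diffOp_iterate_eq_zero (hd : 0 < d) {F : ℤ → ℤ} {s : ℕ} (g : ℕ → ℚ[X])
    (hg : ∀ i < d, (g i).degree < s)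
    (hF : ∀ i < d, ∀ᶠ n : ℤ in atTop, (g i).eval (n : ℚ) = (F (d * n + i) : ℚ)) :
    ∀ᶠ n in atTop, (diffOp d)^[s] F n = 0 := by
  have hF' : ∀ᶠ n : ℤ in atTop, ∀ i ∈ Finset.range d, (g i).eval (n : ℚ) = (F (d * n + i) : ℚ) :=
    (Filter.eventually_all_finset _).mpr fun i hi => hF i (Finset.mem_range.mp hi)
  obtain ⟨N, hN⟩ := eventually_atTop.mp hF'
  refine eventually_atTop.mpr ⟨d * N, fun n hn => ?_⟩
  have hd' : (0 : ℤ) < d := by exact_mod_cast hd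
  obtain ⟨i, hi⟩ := Int.eq_ofNat_of_zero_le (Int.emod_nonneg n hd'.ne')
  have hid : i < d := by
    have := Int.emod_lt_of_pos n hd'
    omega
  have hn' : n = d * (n / d) + i := by rw [← hi, Int.mul_ediv_add_emod]
  set q := n / d with hq
  have hqN : N ≤ q := Int.le_ediv_of_mul_le hd' (by rwa [mul_comm])
  have hΔ : (fwdDiff (1 : ℚ))^[s] (g i).eval (q : ℚ) = 0 := by
    by_cases h0 : g i = 0
    · rw [h0, fwdDiff_iter_eq_sum_shift]
      simp
    · rw [fwdDiff_iter_eq_zero_of_degree_lt ((natDegree_lt_iff_degree_lt h0).mpr (hg i hid))]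
      rfl
  have : (((diffOp d)^[s] F n : ℤ) : ℚ) = 0 := by
    rw [← hΔ, diffOp_eq_fwdDiff, fwdDiff_iter_eq_sum_shift, fwdDiff_iter_eq_sum_shift]
    push_cast
    refine Finset.sum_congr rfl fun k _ => ?_
    have := hN (q + k) (by omega) i (Finset.mem_range.mpr hid)
    push_cast at this
    simp only [smul_eq_mul, zsmul_eq_mul, nsmul_eq_mul, mul_one]
    push_cast
    rw [this, hn']
    congr 3
    ring
  exact_mod_cast this

end DiffOp

/-! ### Complexity in terms of differences -/

section Hilbert

variable {R : Type*} [CommRing R] {𝒜 : ℕ → AddSubgroup R} [GradedRing 𝒜]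
  {C : Type*} [Category* C] [Preadditive C] [HasShift C ℤ]
  [∀ n : ℤ, (shiftFunctor C n).Additive] {φ : CentralAction 𝒜 C} {X Y : C} {d : ℕ}

lemma IsHilbertPoly.unique {i : ℕ} {g g' : ℚ[X]} (h : IsHilbertPoly φ d X Y i g)
    (h' : IsHilbertPoly φ d X Y i g') : g = g' := by
  obtain ⟨N, hN⟩ := eventually_atTop.mp (h.and h')
  refine Polynomial.eq_of_infinite_eval_eq _ _
    (((Set.Ici_infinite N).image Int.cast_injective.injOn).mono ?_)
  rintro _ ⟨n, hn, rfl⟩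
  exact (hN n hn).1.trans (hN n hn).2.symm

lemma IsHilbertPoly.hilbertPoly_eq {i : ℕ} {g : ℚ[X]} (h : IsHilbertPoly φ d X Y i g) :
    hilbertPoly φ d X Y i = g := by
  have hex : ∃ g, IsHilbertPoly φ d X Y i g := ⟨g, h⟩
  rw [hilbertPoly, dif_pos hex]
  exact hex.choose_spec.unique h

/-- The hypothesis for some `t` guarantees that Hilbert polynomials exist; otherwise `hilbertPoly`
could be its default `0`, and a bound on `cx` would carry no information. -/
lemma cx_le_iff (hd : 0 < d) {t : ℕ}
    (ht : ∀ᶠ n in atTop, (diffOp d)^[t] (fun n => (lam φ X Y n : ℤ)) n = 0) (s : ℕ) :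
    cx φ d X Y ≤ s ↔ ∀ᶠ n in atTop, (diffOp d)^[s] (fun n => (lam φ X Y n : ℤ)) n = 0 := by
  have hdeg : cx φ d X Y ≤ s ↔ ∀ i < d, (hilbertPoly φ d X Y i).degree < s := by
    rw [cx, Finset.sup_le_iff]
    simp only [Finset.mem_range]
    refine forall₂_congr fun i _ => ?_
    split_ifs with h
    · simp [h]
    · rw [← natDegree_lt_iff_degree_lt h, Nat.succ_le_iff]
  have hpoly {u : ℕ} (hu : ∀ᶠ n in atTop, (diffOp d)^[u] (fun n => (lam φ X Y n : ℤ)) n = 0)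
      (i : ℕ) : ∃ g : ℚ[X], g.degree < u ∧ IsHilbertPoly φ d X Y i g := by
    obtain ⟨g, hg, h⟩ := exists_polynomial_of_diffOp_iterate hd hu i
    exact ⟨g, hg, h.mono fun n hn => by simpa using hn⟩
  rw [hdeg]
  constructor
  · intro h
    refine eventually_diffOp_iterate_eq_zero hd (hilbertPoly φ d X Y) h fun i _ => ?_
    obtain ⟨g, -, hg⟩ := hpoly ht i
    rw [hg.hilbertPoly_eq]
    exact hg.mono fun n hn => by simpa using hn
  · intro h i _
    obtain ⟨g, hg', hg⟩ := hpoly h i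
    rwa [hg.hilbertPoly_eq]

end Hilbert

/-! ### Herbrand differences and eventual values -/

section Herbrand

variable {R : Type*} [CommRing R] {𝒜 : ℕ → AddSubgroup R} [GradedRing 𝒜]
  {C : Type*} [Category* C] [Preadditive C] [HasShift C ℤ]
  [∀ n : ℤ, (shiftFunctor C n).Additive] {φ : CentralAction 𝒜 C} {X Y : C} {d : ℕ}

lemma negOnePow_add_even (hd : Even d) (n : ℤ) :
    ((n + d).negOnePow : ℤ) = (n.negOnePow : ℤ) := by
  rw [Int.negOnePow_add, Int.negOnePow_even (d : ℤ) (by exact_mod_cast hd), mul_one]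

lemma diffOp_herbrand (hd : Even d) (n : ℤ) :
    diffOp d (herbrand φ d X Y) n =
      ∑ i ∈ Finset.range d, ((n + i).negOnePow : ℤ) *
        diffOp d (fun n => (lam φ X Y n : ℤ)) (n + i) := by
  simp only [diffOp, herbrand, ← Finset.sum_sub_distrib]
  refine Finset.sum_congr rfl fun i _ => ?_
  rw [add_right_comm n (d : ℤ) i, negOnePow_add_even hd, mul_sub]

lemma diffOp_iterate_herbrand (hd : Even d) (s : ℕ) (n : ℤ) :
    (diffOp d)^[s] (herbrand φ d X Y) n =
      ∑ i ∈ Finset.range d, ((n + i).negOnePow : ℤ) *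
        (diffOp d)^[s] (fun n => (lam φ X Y n : ℤ)) (n + i) := by
  induction s generalizing n with
  | zero => rfl
  | succ s ih =>
    simp only [Function.iterate_succ_apply', diffOp]
    rw [ih, ih, ← Finset.sum_sub_distrib]
    refine Finset.sum_congr rfl fun i _ => ?_
    rw [add_right_comm n (d : ℤ) i, negOnePow_add_even hd, mul_sub]

lemma eventually_forall_add {p : ℤ → Prop} (h : ∀ᶠ n in atTop, p n) :
    ∀ᶠ n in atTop, ∀ i : ℕ, p (n + i) := by
  obtain ⟨N, hN⟩ := eventually_atTop.mp h
  exact eventually_atTop.mpr ⟨N, fun n hn i => hN _ (by omega)⟩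

lemma eventually_diffOp_iterate_herbrand (hd : Even d) {s : ℕ}
    (h : ∀ᶠ n in atTop, (diffOp d)^[s] (fun n => (lam φ X Y n : ℤ)) n = 0) :
    ∀ᶠ n in atTop, (diffOp d)^[s] (herbrand φ d X Y) n = 0 := by
  filter_upwards [eventually_forall_add h] with n hn
  rw [diffOp_iterate_herbrand hd]
  exact Finset.sum_eq_zero fun i _ => by rw [hn i, mul_zero]

/-- Consecutive windows share all but their end terms, which carry the same sign because `d` is
even. -/
lemma herbrand_add_one (hd : Even d) (n : ℤ) :
    herbrand φ d X Y (n + 1) - herbrand φ d X Y n =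
      (n.negOnePow : ℤ) * (lam φ X Y (n + d) - lam φ X Y n) := by
  rw [herbrand, herbrand, ← Finset.sum_sub_distrib, mul_sub, ← negOnePow_add_even hd n]
  have h := Finset.sum_range_sub
    (fun i : ℕ => ((n + i).negOnePow : ℤ) * (lam φ X Y (n + i) : ℤ)) d
  simp only [Nat.cast_zero, add_zero] at h
  rw [negOnePow_add_even hd n] at h ⊢
  rw [← h]
  refine Finset.sum_congr rfl fun i _ => ?_
  push_cast
  rw [add_assoc, add_comm 1 (i : ℤ)]

lemma eventualValue_eq {f : ℤ → ℤ} {c : ℤ} (h : ∀ᶠ n in atTop, f n = c) : eventualValue f = c := by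
  have hex : ∃ c : ℤ, ∀ᶠ n in atTop, f n = c := ⟨c, h⟩
  rw [eventualValue, dif_pos hex]
  obtain ⟨n, hn₁, hn₂⟩ := (h.and hex.choose_spec).exists
  exact hn₂.symm.trans hn₁

lemma eventualValue_congr {f g : ℤ → ℤ} (h : ∀ᶠ n in atTop, f n = g n) :
    eventualValue f = eventualValue g := by
  have : ∀ c : ℤ, (∀ᶠ n in atTop, f n = c) ↔ ∀ᶠ n in atTop, g n = c := fun c =>
    eventually_congr (h.mono fun n hn => by rw [hn])
  by_cases h : ∃ c : ℤ, ∀ᶠ n in atTop, g n = c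
  · obtain ⟨c, hc⟩ := h
    rw [eventualValue_eq hc, eventualValue_eq ((this c).mpr hc)]
  · rw [eventualValue, eventualValue, dif_neg h, dif_neg (by simpa only [this] using h)]

end Herbrand

/-! ### The annihilator in large degrees -/

section Annihilator

variable {R : Type*} [CommRing R] {𝒜 : ℕ → AddSubgroup R} [GradedRing 𝒜]
  {C : Type*} [Category* C] [Preadditive C] [HasShift C ℤ]
  [∀ n : ℤ, (shiftFunctor C n).Additive] {φ : CentralAction 𝒜 C} {X Y : C}

variable (φ X Y) in
lemma homGE_mono {m n : ℤ} (h : m ≤ n) : HomGE φ X Y n ≤ HomGE φ X Y m :=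
  fun _ hx k hk => hx k (hk.trans_le h)

lemma homGE_le {N : Submodule R (HomStar φ X Y)} {n₀ : ℤ}
    (h : ∀ n, n₀ ≤ n → ∀ f, HomStar.of φ X Y n f ∈ N) : HomGE φ X Y n₀ ≤ N := by
  classical
  intro x hx
  have hsum : x = ∑ n ∈ DFinsupp.support (β := HomDeg φ X Y) x,
      HomStar.of φ X Y n (HomStar.coeff n x) :=
    (DirectSum.sum_support_of (β := HomDeg φ X Y) x).symm
  rw [hsum]
  refine sum_mem fun n _ => ?_
  by_cases hn : n₀ ≤ n
  · exact h n hn _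
  · rw [hx n (not_le.mp hn), map_zero]
    exact zero_mem _

variable (φ X Y) in
/-- The ideal of elements of `R` annihilating `Hom(X, Σⁿ Y)` for `n ≫ 0`. -/
def eventualAnnihilator : Ideal R where
  carrier := {r | ∃ N : ℤ, ∀ x ∈ HomGE φ X Y N, r • x = 0}
  zero_mem' := ⟨0, fun x _ => zero_smul R x⟩
  add_mem' := by
    rintro r s ⟨N, hN⟩ ⟨N', hN'⟩
    refine ⟨max N N', fun x hx => ?_⟩
    rw [add_smul, hN x (homGE_mono φ X Y (le_max_left _ _) hx),
      hN' x (homGE_mono φ X Y (le_max_right _ _) hx), add_zero]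
  smul_mem' := by
    rintro r s ⟨N, hN⟩
    exact ⟨N, fun x hx => by rw [smul_assoc, hN x hx, smul_zero]⟩

/-- In large degrees multiplication by `z` is both injective and zero. -/
lemma eventually_lam_eq_zero_of_mem {d : ℕ} {z : 𝒜 d} (hz : EventuallyInjective φ z X Y)
    (h : (z : R) ∈ eventualAnnihilator φ X Y) : ∀ᶠ n in atTop, lam φ X Y n = 0 := by
  obtain ⟨N, hN⟩ := h
  filter_upwards [hz, eventually_ge_atTop N] with n hn hNn
  have : Subsingleton (HomDeg φ X Y n) := by
    refine subsingleton_of_forall_eq 0 fun f => (injective_iff_map_eq_zero _).mp hn f ?_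
    apply of_injective
    rw [← smul_of z, hN _ (of_mem_homGE hNn f), map_zero]
  rw [lam, homLength, Module.length_eq_zero]
  rfl

end Annihilator

/-! ### Passing from `Y` to `Y⫽z` -/

section Koszul

variable {R : Type*} [CommRing R] {𝒜 : ℕ → AddSubgroup R} [GradedRing 𝒜]
  {C : Type*} [Category* C] [Preadditive C] [Limits.HasZeroObject C] [HasShift C ℤ]
  [∀ n : ℤ, (shiftFunctor C n).Additive] [Pretriangulated C] {φ : CentralAction 𝒜 C} {X Y K : C}
  {d : ℕ} {z : 𝒜 d}

/-- The kernel lengths `κ` are kept because the Euler characteristic involves every degree,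
including those where `z` is not injective. -/
lemma IsKoszulObject.exists_lam_eq (hd : Even d) (hK : IsKoszulObject φ Y z K)
    (hY : ∀ n, homLength φ X Y n ≠ ⊤) :
    (∀ n, homLength φ X K n ≠ ⊤) ∧
    (∀ n, homLength φ X Y (n + d) = 0 → homLength φ X Y (n + 1) = 0 → homLength φ X K n = 0) ∧
    ∃ κ : ℤ → ℕ, ∀ n,
      (lam φ X K n : ℤ) = lam φ X Y (n + d) - lam φ X Y n + κ n + κ (n + 1) ∧
      κ n ≤ lam φ X Y n ∧
      (Function.Injective (act z (add_comm _ _) : HomDeg φ X Y n →+ HomDeg φ X Y (n + d)) →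
        κ n = 0) := by
  obtain ⟨γ, δ, h₁, h₂, h₃, -⟩ := hK.exists_exact hd
  obtain ⟨κ, ρ, c, h⟩ := exists_homLength_eq (h₁ X) (h₂ X) (h₃ X)
  have hκ (n) : κ n ≠ ⊤ := fun h' => hY n (by rw [(h n).1, h', top_add])
  have hρ (n) : ρ n ≠ ⊤ := fun h' => hY n (by rw [(h n).1, h', add_top])
  have hc (n) : c n ≠ ⊤ := fun h' => hY (n + d) (by rw [(h n).2.1, h', add_top])
  refine ⟨fun n => ?_, fun n hn hn' => ?_, fun n => (κ n).toNat, fun n => ⟨?_, ?_, fun hz => ?_⟩⟩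
  · rw [(h n).2.2.1]
    exact WithTop.add_ne_top.mpr ⟨hc n, hκ _⟩
  · rw [(h n).2.1, add_eq_zero] at hn
    rw [(h (n + 1)).1, add_eq_zero] at hn'
    rw [(h n).2.2.1, hn.2, hn'.1, add_zero]
  · simp only [lam]
    rw [(h n).1, (h n).2.1, (h n).2.2.1, ENat.toNat_add (hκ n) (hρ n),
      ENat.toNat_add (hρ n) (hc n), ENat.toNat_add (hc n) (hκ _)]
    push_cast
    ring
  · rw [lam, (h n).1, ENat.toNat_add (hκ n) (hρ n)]
    exact Nat.le_add_right _ _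
  · exact (congrArg ENat.toNat ((h n).2.2.2 hz)).trans ENat.toNat_zero

lemma IsKoszulObject.eventually_lam_eq (hd : Even d) (hK : IsKoszulObject φ Y z K)
    (hY : ∀ n, homLength φ X Y n ≠ ⊤) (hz : EventuallyInjective φ z X Y) :
    ∀ᶠ n in atTop, (lam φ X K n : ℤ) = diffOp d (fun n => (lam φ X Y n : ℤ)) n := by
  obtain ⟨-, -, κ, hκ⟩ := hK.exists_lam_eq (X := X) hd hY
  filter_upwards [hz, (tendsto_atTop_add_const_right atTop (1 : ℤ) tendsto_id).eventually hz]
    with n h₀ h₁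
  rw [(hκ n).1, (hκ n).2.2 h₀, (hκ (n + 1)).2.2 h₁]
  simp [diffOp]

lemma IsKoszulObject.boundedBelow (hd : Even d) (hK : IsKoszulObject φ Y z K)
    (hY : ∀ n, homLength φ X Y n ≠ ⊤) (hb : BoundedBelow φ X Y) : BoundedBelow φ X K := by
  obtain ⟨N, hN⟩ := eventually_atBot.mp hb
  refine eventually_atBot.mpr ⟨N - d - 1, fun n hn => ?_⟩
  exact (hK.exists_lam_eq hd hY).2.1 n (hN _ (by omega)) (hN _ (by omega))

/-- If `z` is eventually injective then `Hom*(X, Y⫽z)` is, in large degrees, the image of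
`Hom*(X, Y)` under an `R`-linear map. -/
lemma IsKoszulObject.exists_linearMap (hd : Even d)
    (heven : ∀ m, ¬ Even m → ∀ r : 𝒜 m, r = 0) (hK : IsKoszulObject φ Y z K)
    (hz : EventuallyInjective φ z X Y) :
    ∃ (Φ : HomStar φ X Y →ₗ[R] HomStar φ X K) (N : ℤ),
      (∀ n, N ≤ n → HomGE φ X K n ≤ (HomGE φ X Y (n + d)).map Φ) ∧
      ∀ x, (z : R) • Φ x = 0 := by
  obtain ⟨γ, δ, h₁, h₂, h₃, h₄⟩ := hK.exists_exact hd
  obtain ⟨N, hN⟩ := eventually_atTop.mp hz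
  refine ⟨postStar heven φ X γ, N, fun n hn => homGE_le fun k hk w => ?_, fun x => ?_⟩
  -- The image of `w` under `δ` is killed by `z`, hence zero by injectivity, so `w` comes from `γ`.
  · have hw : post φ X δ (add_comm 1 k) w = 0 := by
      refine (injective_iff_map_eq_zero _).mp (hN (k + 1) (by omega)) _ ?_
      exact ((h₃ X k (k + 1) _ (add_comm _ _) (add_comm _ _)) _).mpr ⟨w, rfl⟩
    obtain ⟨f, hf⟩ := ((h₂ X k (k + d) (k + 1) (by ring) (add_comm _ _)) w).mp hw
    exact ⟨HomStar.of φ X Y (k + d) f, of_mem_homGE (by omega) f,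
      (postStar_of heven γ (show -(d : ℤ) + (k + d) = k by ring) f).trans (by rw [hf])⟩
  · induction x using homStar_induction with
    | zero => rw [map_zero, smul_zero]
    | add x y hx hy => rw [map_add, smul_add, hx, hy, add_zero]
    | of n f =>
      rw [postStar_of heven γ rfl, smul_of z rfl, h₄, map_zero]

lemma IsKoszulObject.noethFL (hd : Even d)
    (heven : ∀ m, ¬ Even m → ∀ r : 𝒜 m, r = 0) (hK : IsKoszulObject φ Y z K)
    (hz : EventuallyInjective φ z X Y) (hXY : NoethFL φ X Y) : NoethFL φ X K := by
  refine ⟨?_, (hK.exists_lam_eq hd hXY.finite_length).1⟩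
  obtain ⟨Φ, N, hΦ, -⟩ := hK.exists_linearMap hd heven hz
  obtain ⟨n₀, hn₀⟩ := hXY.eventually_noetherian
  have : IsNoetherian R (HomGE φ X Y (max N n₀ + d)) :=
    isNoetherian_of_le (homGE_mono φ X Y (show n₀ ≤ _ by omega))
  exact ⟨max N n₀, isNoetherian_of_le (hΦ _ (le_max_left _ _))⟩

/-- In large degrees `Hom*(X, Y⫽z)` is covered by a linear image of `Hom*(X, Y)` on which `z` acts
as zero. -/
lemma IsKoszulObject.eventualAnnihilator_le (hd : Even d)
    (heven : ∀ m, ¬ Even m → ∀ r : 𝒜 m, r = 0) (hK : IsKoszulObject φ Y z K)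
    (hz : EventuallyInjective φ z X Y) :
    eventualAnnihilator φ X Y ≤ eventualAnnihilator φ X K ∧
      (z : R) ∈ eventualAnnihilator φ X K := by
  obtain ⟨Φ, N, hΦ, hzΦ⟩ := hK.exists_linearMap hd heven hz
  constructor
  · rintro r ⟨M, hM⟩
    refine ⟨max N M, fun x hx => ?_⟩
    obtain ⟨y, hy, rfl⟩ := hΦ _ (le_max_left _ _) hx
    rw [← map_smul, hM y (homGE_mono φ X Y (by omega) hy), map_zero]
  · refine ⟨N, fun x hx => ?_⟩
    obtain ⟨y, -, rfl⟩ := hΦ _ le_rfl hx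
    exact hzΦ y

/-- The Hilbert functions of `Hom*(X, Y)` are eventually polynomial. -/
theorem NoethFL.exists_diffOp_iterate_eq_zero [IsNoetherianRing R] (hd : 0 < d) (hde : Even d)
    (hgen : Algebra.adjoin (𝒜 0) (𝒜 d : Set R) = ⊤) (hR0 : ContainsInfiniteFieldOrLocal 𝒜)
    {kos : C → 𝒜 d → C} (hkos : ∀ (Y : C) (z : 𝒜 d), IsKoszulObject φ Y z (kos Y z))
    (hXY : NoethFL φ X Y) :
    ∃ t, ∀ᶠ n in atTop, (diffOp d)^[t] (fun n => (lam φ X Y n : ℤ)) n = 0 := by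
  have heven := eq_zero_of_not_even hd hde hgen
  -- If `z` is already in the annihilator, the lengths are eventually zero. Otherwise the
  -- annihilator for `Y⫽z` is strictly larger, and its lengths are the differences of those for `Y`.
  induction hI : eventualAnnihilator φ X Y using WellFoundedGT.induction generalizing Y with
  | _ I ih =>
  subst hI
  obtain ⟨z, hz⟩ := exists_eventuallyInjective hd hgen hR0 hXY
  by_cases hzI : (z : R) ∈ eventualAnnihilator φ X Y
  · exact ⟨0, (eventually_lam_eq_zero_of_mem hz hzI).mono fun n hn => by simp [hn]⟩
  · obtain ⟨hle, hzK⟩ := (hkos Y z).eventualAnnihilator_le (X := X) hde heven hz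
    obtain ⟨t, ht⟩ := ih _ (lt_of_le_of_ne hle fun h => hzI (h ▸ hzK))
      ((hkos Y z).noethFL hde heven hz hXY) rfl
    refine ⟨t + 1, ?_⟩
    filter_upwards [ht, diffOp_iterate_congr (d := d)
      ((hkos Y z).eventually_lam_eq hde hXY.finite_length hz) t] with n h₁ h₂
    rw [Function.iterate_succ_apply, ← h₁]
    exact h₂.symm

lemma IsKoszulObject.eventually_herbrand_eq (hd : Even d) (hK : IsKoszulObject φ Y z K)
    (hY : ∀ n, homLength φ X Y n ≠ ⊤) (hz : EventuallyInjective φ z X Y) :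
    ∀ᶠ n in atTop, herbrand φ d X K n = diffOp d (herbrand φ d X Y) n := by
  filter_upwards [eventually_forall_add (hK.eventually_lam_eq hd hY hz)] with n hn
  rw [diffOp_herbrand hd, herbrand]
  exact Finset.sum_congr rfl fun i _ => by rw [hn i]

lemma sum_Ico_sub (A : ℤ → ℤ) {a b : ℤ} (hab : a ≤ b) :
    ∑ n ∈ Finset.Ico a b, (A (n + 1) - A n) = A b - A a := by
  induction b, hab using Int.leInduction with
  | base => simp
  | succ b hb ih =>
    rw [← Finset.insert_Ico_right_eq_Ico_add_one hb, Finset.sum_insert (by simp), ih]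
    ring

/-- The function `A(n) = h(X, Y)(n) - (-1)ⁿκ(n)` has first differences `(-1)ⁿλⁿ(X, K)`. It is zero
at a sufficiently low degree and equals `h(X, Y)` in high degrees, where `κ` vanishes. -/
lemma IsKoszulObject.eventually_herbrand_eq_eulerChar (hd : Even d) (hK : IsKoszulObject φ Y z K)
    (hY : ∀ n, homLength φ X Y n ≠ ⊤) (hz : EventuallyInjective φ z X Y) (hb : BoundedBelow φ X Y)
    (hKz : ∀ᶠ n in atTop, lam φ X K n = 0) :
    ∀ᶠ n in atTop, herbrand φ d X Y n = eulerChar φ X K := by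
  have hbK := hK.boundedBelow hd hY hb
  obtain ⟨-, -, κ, hκ⟩ := hK.exists_lam_eq (X := X) hd hY
  let A : ℤ → ℤ := fun n => herbrand φ d X Y n - (n.negOnePow : ℤ) * κ n
  have hA (n : ℤ) : (n.negOnePow : ℤ) * lam φ X K n = A (n + 1) - A n := by
    have := herbrand_add_one (φ := φ) (X := X) (Y := Y) hd n
    simp only [A]
    rw [(hκ n).1, Int.negOnePow_succ]
    push_cast
    linear_combination -this
  obtain ⟨a, ha⟩ := eventually_atBot.mp (hb.and hbK)
  -- Starting at `a - d` keeps the whole window of `d` degrees in `h` below `a`.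
  have hA₀ : A (a - d) = 0 := by
    have h0 (n : ℤ) (hn : n ≤ a) : lam φ X Y n = 0 := by rw [lam, (ha n hn).1, ENat.toNat_zero]
    have : κ (a - d) = 0 := Nat.le_zero.mp ((hκ _).2.1.trans (h0 _ (by omega)).le)
    simp only [A, this, herbrand]
    rw [Finset.sum_eq_zero fun i hi => ?_]
    · simp
    · have := Finset.mem_range.mp hi
      rw [h0 _ (by omega), Nat.cast_zero, mul_zero]
  obtain ⟨N, hN⟩ := eventually_atTop.mp (hKz.and hz)
  refine eventually_atTop.mpr ⟨max N (a - d), fun n hn => ?_⟩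
  have hAn : A n = herbrand φ d X Y n := by
    simp only [A]
    rw [(hκ n).2.2 (hN n (by omega)).2]
    simp
  rw [← hAn, eulerChar, finsum_eq_sum_of_support_subset (s := Finset.Ico (a - d) n)]
  · simp only [hA]
    rw [sum_Ico_sub A ((le_max_right _ _).trans hn), hA₀, sub_zero]
  · intro k hk
    rw [Function.mem_support] at hk
    rw [Finset.coe_Ico, Set.mem_Ico]
    by_contra hcon
    apply hk
    have : lam φ X K k = 0 := by
      rcases not_and_or.mp hcon with h | h
      · rw [lam, (ha k (by omega)).2, ENat.toNat_zero]
      · exact (hN k (by omega)).1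
    rw [this, Nat.cast_zero, mul_zero]

end Koszul

end TriangMult

end

/-! ### The characterization of the multiplicity -/

theorem mainTheorem5
    {R : Type*} [CommRing R] [IsNoetherianRing R] (𝒜 : ℕ → AddSubgroup R) [GradedRing 𝒜]
    {C : Type*} [Category* C] [Preadditive C] [Limits.HasZeroObject C] [HasShift C ℤ]
    [∀ n : ℤ, (shiftFunctor C n).Additive] [Pretriangulated C] [IsTriangulated C]
    (φ : TriangMult.CentralAction 𝒜 C)
    (d : ℕ) (hd : 0 < d) (hd_even : Even d)
    (hgen : Algebra.adjoin (𝒜 0) (𝒜 d : Set R) = ⊤)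
    (hR0 : TriangMult.ContainsInfiniteFieldOrLocal 𝒜)
    (kos : C → 𝒜 d → C) (hkos : ∀ (Y : C) (z : 𝒜 d), TriangMult.IsKoszulObject φ Y z (kos Y z))
    (f : ∀ (s : ℕ) (X Y : C), TriangMult.MultDomain φ d s X Y → ℤ) :
    TriangMult.MultiplicityAxioms φ d kos f ↔
      ∀ (s : ℕ) (X Y : C) (h : TriangMult.MultDomain φ d s X Y),
        f s X Y h = TriangMult.multiplicity φ d s X Y := by
  have cx_le_iff {X Y : C} (h : TriangMult.NoethFL φ X Y) (s : ℕ) :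
      TriangMult.cx φ d X Y ≤ s ↔ ∀ᶠ n in Filter.atTop,
        (TriangMult.diffOp d)^[s] (fun n => (TriangMult.lam φ X Y n : ℤ)) n = 0 := by
    obtain ⟨t, ht⟩ := h.exists_diffOp_iterate_eq_zero hd hd_even hgen hR0 hkos
    exact TriangMult.cx_le_iff hd ht s
  have vanishing (s : ℕ) (X Y : C) (h : TriangMult.MultDomain φ d s X Y)
      (hs : TriangMult.cx φ d X Y < s) : TriangMult.multiplicity φ d s X Y = 0 := by
    obtain ⟨s, rfl⟩ := Nat.exists_eq_succ_of_ne_zero hs.ne_bot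
    exact TriangMult.eventualValue_eq (TriangMult.eventually_diffOp_iterate_herbrand hd_even
      ((cx_le_iff h.noethFL s).mp (Nat.le_of_lt_succ hs)))
  have koszul (s : ℕ) (X Y : C) (h : TriangMult.MultDomain φ d (s + 1) X Y) (z : 𝒜 d)
      (hz : TriangMult.EventuallyInjective φ z X Y)
      (h' : TriangMult.MultDomain φ d s X (kos Y z)) :
      TriangMult.multiplicity φ d (s + 1) X Y = TriangMult.multiplicity φ d s X (kos Y z) := by
    have hY := h.noethFL.finite_length
    cases s with
    | zero =>
      refine TriangMult.eventualValue_eq ((hkos Y z).eventually_herbrand_eq_eulerChar hd_even hY hz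
        h.boundedBelow ?_)
      filter_upwards [(cx_le_iff h'.noethFL 0).mp h'.cx_le] with n hn
      exact Nat.cast_eq_zero.mp hn
    | succ s =>
      refine (TriangMult.eventualValue_congr ?_).symm
      exact TriangMult.diffOp_iterate_congr ((hkos Y z).eventually_herbrand_eq hd_even hY hz) s
  constructor
  · intro hf s
    induction s with
    | zero => exact fun X Y h => hf.euler X Y h (Nat.le_zero.mp h.cx_le)
    | succ s ih =>
      intro X Y h
      rcases h.cx_le.lt_or_eq with hs | hs
      · rw [hf.vanishing _ X Y h hs, vanishing _ X Y h hs]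
      · obtain ⟨z, hz⟩ := TriangMult.exists_eventuallyInjective hd hgen hR0 h.noethFL
        have heven := TriangMult.eq_zero_of_not_even hd hd_even hgen
        have hK := (hkos Y z).noethFL hd_even heven hz h.noethFL
        -- The Koszul axiom speaks only of pairs in the domain. Here `Δˢλ(X, Y⫽z) = Δˢ⁺¹λ(X, Y) = 0`
        -- eventually, so the complexity drops as required.
        have h' : TriangMult.MultDomain φ d s X (kos Y z) := by
          refine ⟨hK, (hkos Y z).boundedBelow hd_even h.noethFL.finite_length h.boundedBelow,
            (cx_le_iff hK s).mpr ?_⟩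
          filter_upwards [(cx_le_iff h.noethFL (s + 1)).mp h.cx_le,
            TriangMult.diffOp_iterate_congr (d := d)
              ((hkos Y z).eventually_lam_eq hd_even h.noethFL.finite_length hz) s] with n h₁ h₂
          exact h₂.trans h₁
        rw [hf.koszul s X Y h hs z hz h', ih X _ h', koszul s X Y h z hz h']
  · intro hf
    refine ⟨fun s X Y h hs => ?_, fun X Y h _ => hf 0 X Y h, fun s X Y h _ z hz h' => ?_⟩
    · rw [hf, vanishing s X Y h hs]
    · rw [hf, hf, koszul s X Y h z hz h']
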